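/- For a group $\Gamma$ and a subgroup $H\le\Gamma$, say that the pair $(\Gamma,H)$ satisfies Moore's conjecture if (a) no element of $\Gamma\setminus H$ has prime order, and (b) every $\mathbb{Z}\Gamma$-module which is projective over $\mathbb{Z}H$ is also projective over $\mathbb{Z}\Gamma$. Let $\Gamma,\Gamma'$ be groups, and let $H\trianglelefteq\Gamma$ and $H'\trianglelefteq\Gamma'$ be normal subgroups of finite index. Let $\varphi:\Gamma\to\Gamma'$ be a group homomorphism with $\varphi(H)\subseteq H'$ such that the induced homomorphism $\Gamma/H\to\Gamma'/H'$ is an isomorphism. If $(\Gamma',H')$ satisfies Moore's conjecture, then $(\Gamma,H)$ satisfies Moore's conjecture. -/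

import Mathlib

universe u v w

/-- Moore's condition for a pair `(Γ, H)`: no element of `Γ` outside `H` has prime order.
(`orderOf g = 0` when `g` has infinite order.) -/
def MooreCondition {Γ : Type u} [Group Γ] (H : Subgroup Γ) : Prop :=
  ∀ g : Γ, g ∉ H → ¬ (orderOf g).Prime

/-- A `ℤΓ`-module `M` is projective over `ℤH`: the module obtained from `M` by restriction of
scalars along the inclusion of group rings `ℤH → ℤΓ` is a projective `ℤH`-module. -/
def ProjectiveOverSubgroup {Γ : Type u} [Group Γ] (H : Subgroup Γ)
    (M : Type w) [AddCommGroup M] [Module (MonoidAlgebra ℤ Γ) M] : Prop :=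
  letI : Module (MonoidAlgebra ℤ H) M :=
    Module.compHom M (MonoidAlgebra.mapDomainRingHom ℤ H.subtype)
  Module.Projective (MonoidAlgebra ℤ H) M

/-- Moore's conjecture holds for the pair `(Γ, H)`: Moore's condition holds for `(Γ, H)`, and every
`ℤΓ`-module which is projective over `ℤH` is projective over `ℤΓ`.  Modules range over an
arbitrary universe that is at least as large as that of `Γ`. -/
def SatisfiesMooreConjecture {Γ : Type u} [Group Γ] (H : Subgroup Γ) : Prop :=
  MooreCondition H ∧
    ∀ (M : Type (max u w)) [AddCommGroup M] [Module (MonoidAlgebra ℤ Γ) M],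
      ProjectiveOverSubgroup H M → Module.Projective (MonoidAlgebra ℤ Γ) M

/-! Condition (a) lifts because `φ` sends an element of prime order outside `H` to one of the same
order outside `H'`. For (b), an Eilenberg swindle makes `M` a ℤΓ-summand of a module `Y` which is
free over ℤH. By Higman's criterion `Y` is projective over ℤΓ once some H-equivariant endomorphism
`θ` has relative trace `∑ g θ g⁻¹ = 1`. Such a `θ` is found in three steps.

Local to global (`LocallyTrace.exists_relTrace_eq_id`): it suffices that each single `x` is fixed by
some relative trace Tr θ. Replacing `θ₁` by `θ₁ + θ₂(1 - Tr θ₁)` fixes further elements without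
changing `θ₁` where its trace is already the identity, so countable iteration and Zorn's lemma
apply.

Local (`locallyTrace_of_coinvariantsAreNorms`): let `ξ = ∑ g ⊗ g⁻¹x` in ℤΓ ⊗_{ℤH} Y, and let `A` be
the right ideal generated by its coordinates in a ℤH-basis of `Y`. Then `ξ` is a Γ-invariant element
of A ⊗_{ℤH} Y = (A ⊗ Y)_H. If it is a norm, then `x` lies in AY, and every element of AY is the
value at `x` of a relative trace.

Norms (`coinvariantsAreNorms_of_relTrace_eq_id`): W = A ⊗ Y is free over ℤH because `A` is free over
ℤ. The induced module ℤΓ' ⊗_{ℤΓ} W is free over ℤH', hence projective over ℤΓ' by hypothesis, so its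
identity is a relative trace. Its H'-coinvariants are W_H with the same action of Γ'/H' ≅ Γ/H, so
invariant classes in W_H are norms. -/

/-! ### Relative traces of H-equivariant maps. -/

section RelativeTrace

variable {k Γ : Type*} [CommRing k] [Group Γ] {M N P : Type*} [AddCommMonoid M] [AddCommMonoid N] [AddCommMonoid P]
  [Module k M] [Module k N] [Module k P]

/-- The map `θ` commutes with the action of the subgroup `H`. -/
def IsEquivariantOn (H : Subgroup Γ) (ρ : Representation k Γ M) (σ : Representation k Γ N)
    (θ : M →ₗ[k] N) : Prop :=
  ∀ h ∈ H, ∀ x, θ (ρ h x) = σ h (θ x)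

/-- The relative trace `x ↦ ∑ g θ(g⁻¹ x)`, where `g` runs over representatives of `Γ ⧸ H`. -/
noncomputable def relTrace (H : Subgroup Γ) [Fintype (Γ ⧸ H)] (ρ : Representation k Γ M)
    (σ : Representation k Γ N) (θ : M →ₗ[k] N) : M →ₗ[k] N :=
  ∑ g : Γ ⧸ H, σ g.out ∘ₗ θ ∘ₗ ρ g.out⁻¹

variable {H : Subgroup Γ} {ρ : Representation k Γ M} {σ : Representation k Γ N}
  {τ : Representation k Γ P}

theorem IsEquivariantOn.add {θ₁ θ₂ : M →ₗ[k] N} (h₁ : IsEquivariantOn H ρ σ θ₁)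
    (h₂ : IsEquivariantOn H ρ σ θ₂) : IsEquivariantOn H ρ σ (θ₁ + θ₂) := by
  intro h hh x
  simp [h₁ h hh, h₂ h hh]

theorem IsEquivariantOn.comp {θ₁ : M →ₗ[k] N} {θ₂ : N →ₗ[k] P} (h₂ : IsEquivariantOn H σ τ θ₂)
    (h₁ : IsEquivariantOn H ρ σ θ₁) : IsEquivariantOn H ρ τ (θ₂ ∘ₗ θ₁) := by
  intro h hh x
  simp [h₁ h hh, h₂ h hh]

theorem IsEquivariantOn.mono {K : Subgroup Γ} {θ : M →ₗ[k] N} (h : IsEquivariantOn H ρ σ θ)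
    (hK : K ≤ H) : IsEquivariantOn K ρ σ θ :=
  fun g hg x => h g (hK hg) x

theorem isEquivariantOn_id : IsEquivariantOn H ρ ρ LinearMap.id := fun _ _ _ => rfl

/-- The conjugate `g θ g⁻¹` depends only on the coset of `g`. -/
theorem IsEquivariantOn.conj_eq {θ : M →ₗ[k] N} (hθ : IsEquivariantOn H ρ σ θ) {a b : Γ}
    (hab : (a : Γ ⧸ H) = b) (x : M) : σ a (θ (ρ a⁻¹ x)) = σ b (θ (ρ b⁻¹ x)) := by
  have h := QuotientGroup.eq.1 hab
  have : b = a * (a⁻¹ * b) := by group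
  have e1 : ρ a⁻¹ x = ρ (a⁻¹ * b) (ρ b⁻¹ x) := by
    rw [← Module.End.mul_apply, ← map_mul]; congr 2; group
  rw [e1, hθ _ h, ← Module.End.mul_apply, ← map_mul]
  congr 2
  group

variable [Fintype (Γ ⧸ H)]

theorem relTrace_apply (θ : M →ₗ[k] N) (x : M) :
    relTrace H ρ σ θ x = ∑ g : Γ ⧸ H, σ g.out (θ (ρ g.out⁻¹ x)) := by
  simp [relTrace]

/-- The relative trace may be computed with any family of representatives of the cosets. -/
theorem sum_eq_relTrace {θ : M →ₗ[k] N} (hθ : IsEquivariantOn H ρ σ θ) (E : Equiv.Perm (Γ ⧸ H))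
    (r : Γ ⧸ H → Γ) (hr : ∀ g, (r g : Γ ⧸ H) = E g) (x : M) :
    ∑ g, σ (r g) (θ (ρ (r g)⁻¹ x)) = relTrace H ρ σ θ x := by
  rw [relTrace_apply]
  refine Fintype.sum_equiv E _ _ fun g => ?_
  exact hθ.conj_eq ((hr g).trans (QuotientGroup.out_eq' _).symm) x

theorem relTrace_isEquivariant {θ : M →ₗ[k] N} (hθ : IsEquivariantOn H ρ σ θ) :
    IsEquivariantOn ⊤ ρ σ (relTrace H ρ σ θ) := by
  intro γ _ x
  rw [← sum_eq_relTrace hθ (MulAction.toPerm γ) (fun g => γ * g.out) (fun g => ?_),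
    relTrace_apply, map_sum]
  · refine Finset.sum_congr rfl fun g _ => ?_
    have : ρ (γ * g.out)⁻¹ (ρ γ x) = ρ g.out⁻¹ x := by
      rw [← Module.End.mul_apply, ← map_mul]; congr 2; group
    rw [this, map_mul, Module.End.mul_apply]
  · rw [← smul_eq_mul, ← MulAction.Quotient.smul_coe, QuotientGroup.out_eq', MulAction.toPerm_apply]

theorem relTrace_comp {θ : N →ₗ[k] P} {ε : M →ₗ[k] N} (hε : IsEquivariantOn ⊤ ρ σ ε) :
    relTrace H ρ τ (θ ∘ₗ ε) = relTrace H σ τ θ ∘ₗ ε := by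
  ext x
  simp only [relTrace_apply, LinearMap.comp_apply]
  exact Finset.sum_congr rfl fun g _ => by rw [hε _ trivial]

theorem comp_relTrace {θ : M →ₗ[k] N} {ε : N →ₗ[k] P} (hε : IsEquivariantOn ⊤ σ τ ε) :
    relTrace H ρ τ (ε ∘ₗ θ) = ε ∘ₗ relTrace H ρ σ θ := by
  ext x
  simp only [relTrace_apply, LinearMap.comp_apply, map_sum]
  exact Finset.sum_congr rfl fun g _ => by rw [hε _ trivial]

theorem relTrace_add (θ₁ θ₂ : M →ₗ[k] N) :
    relTrace H ρ σ (θ₁ + θ₂) = relTrace H ρ σ θ₁ + relTrace H ρ σ θ₂ := by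
  ext x
  simp [relTrace_apply, Finset.sum_add_distrib]

end RelativeTrace

theorem IsEquivariantOn.sub {k Γ M N : Type*} [CommRing k] [Group Γ] [AddCommMonoid M]
    [AddCommGroup N] [Module k M] [Module k N] {H : Subgroup Γ} {ρ : Representation k Γ M}
    {σ : Representation k Γ N} {θ₁ θ₂ : M →ₗ[k] N} (h₁ : IsEquivariantOn H ρ σ θ₁)
    (h₂ : IsEquivariantOn H ρ σ θ₂) : IsEquivariantOn H ρ σ (θ₁ - θ₂) := by
  intro h hh x
  simp [h₁ h hh, h₂ h hh]

/-! ### Modules free over kH and their coordinate subspaces. -/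

section FreeBasis

variable {k Γ : Type*} [CommRing k] [Group Γ] {M N : Type*} [AddCommMonoid M] [AddCommMonoid N]
  [Module k M] [Module k N] {H : Subgroup Γ}
  {B : Type*}

/-- A `k`-basis of `M` indexed by `H × B` on which `H` acts by translation of the first index,
i.e. a basis of `M` over `kH` indexed by `B`. -/
def IsFreeBasis (ρ : Representation k Γ M) (e : Module.Basis (H × B) k M) : Prop :=
  ∀ (h h' : H) (i : B), ρ h (e (h', i)) = e (h * h', i)

/-- The `kH`-span of the basis elements with index in `S`. -/
def coordSpan (e : Module.Basis (H × B) k M) (S : Set B) : Submodule k M :=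
  Submodule.span k (e '' {p | p.2 ∈ S})

/-- The `H`-equivariant map with prescribed values on a basis. -/
noncomputable def extendMap (σ : Representation k Γ N) (e : Module.Basis (H × B) k M) (f : B → N) :
    M →ₗ[k] N :=
  e.constr k fun p => σ p.1 (f p.2)

variable {ρ : Representation k Γ M} {σ : Representation k Γ N} {e : Module.Basis (H × B) k M}

theorem extendMap_apply (f : B → N) (h : H) (i : B) : extendMap σ e f (e (h, i)) = σ h (f i) := by
  simp [extendMap]

theorem IsFreeBasis.eq (he : IsFreeBasis ρ e) (h : H) (i : B) : e (h, i) = ρ h (e (1, i)) := by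
  rw [he, mul_one]

theorem extendMap_isEquivariantOn (he : IsFreeBasis ρ e) (f : B → N) :
    IsEquivariantOn H ρ σ (extendMap σ e f) := by
  intro h hh x
  lift h to H using hh
  have : extendMap σ e f ∘ₗ ρ h = σ h ∘ₗ extendMap σ e f := by
    refine e.ext fun p => ?_
    obtain ⟨h', i⟩ := p
    simp [he h h' i, extendMap_apply]
  exact LinearMap.congr_fun this x

theorem coordSpan_mono {S T : Set B} (h : S ⊆ T) : coordSpan e S ≤ coordSpan e T :=
  Submodule.span_mono (Set.image_mono fun _ hp => h hp)

theorem mem_coordSpan {S : Set B} (h : H) {i : B} (hi : i ∈ S) : e (h, i) ∈ coordSpan e S :=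
  Submodule.subset_span ⟨_, hi, rfl⟩

theorem mem_coordSpan_of_support {S : Set B} {x : M} (h : ∀ p ∈ (e.repr x).support, p.2 ∈ S) :
    x ∈ coordSpan e S := by
  rw [coordSpan, Module.Basis.mem_span_image]
  exact h

theorem coordSpan_univ : coordSpan e Set.univ = ⊤ := by
  simp [coordSpan, e.span_eq]

theorem map_mem_coordSpan (he : IsFreeBasis ρ e) {S : Set B} (h : H) {x : M}
    (hx : x ∈ coordSpan e S) : ρ h x ∈ coordSpan e S := by
  have : coordSpan e S ≤ (coordSpan e S).comap (ρ h) := by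
    rw [coordSpan, Submodule.span_le]
    rintro _ ⟨⟨h', i⟩, hi, rfl⟩
    rw [SetLike.mem_coe, Submodule.mem_comap, he]
    exact mem_coordSpan _ hi
  exact this hx

/-- A `Γ`-stable submodule contains the coordinate subspace as soon as it contains its basis. -/
theorem coordSpan_le (he : IsFreeBasis ρ e) {S : Set B} {V : Submodule k M}
    (hV : ∀ h ∈ H, ∀ x ∈ V, ρ h x ∈ V) (hS : ∀ i ∈ S, e (1, i) ∈ V) : coordSpan e S ≤ V := by
  rw [coordSpan, Submodule.span_le]
  rintro _ ⟨⟨h', i⟩, hi, rfl⟩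
  rw [he.eq]
  exact hV _ h'.2 _ (hS i hi)

theorem eqOn_coordSpan (he : IsFreeBasis ρ e) {S : Set B} {θ₁ θ₂ : M →ₗ[k] N}
    (h₁ : IsEquivariantOn H ρ σ θ₁) (h₂ : IsEquivariantOn H ρ σ θ₂)
    (h : ∀ i ∈ S, θ₁ (e (1, i)) = θ₂ (e (1, i))) {x : M} (hx : x ∈ coordSpan e S) :
    θ₁ x = θ₂ x := by
  have : coordSpan e S ≤ LinearMap.eqLocus θ₁ θ₂ :=
    coordSpan_le he (fun g hg x hx => by
      rw [LinearMap.mem_eqLocus] at hx ⊢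
      rw [h₁ g hg, h₂ g hg, hx]) h
  exact this hx

theorem exists_finset_coordSpan [DecidableEq B] (T : Finset B) (X : Finset M) :
    ∃ T' : Finset B, T ⊆ T' ∧ ∀ x ∈ X, x ∈ coordSpan e (T' : Set B) := by
  classical
  refine ⟨T ∪ X.biUnion fun x => (e.repr x).support.image Prod.snd, Finset.subset_union_left,
    fun x hx => mem_coordSpan_of_support fun p hp => ?_⟩
  simp only [Finset.coe_union, Set.mem_union, Finset.mem_coe, Finset.mem_biUnion]
  exact Or.inr ⟨x, hx, Finset.mem_image_of_mem _ hp⟩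

end FreeBasis

/-! ### From pointwise relative traces to a global one. -/

section LocalToGlobal

variable {k Γ : Type*} [CommRing k] [Group Γ] {M : Type*} [AddCommGroup M] [Module k M] {H : Subgroup Γ}
  {B : Type*} {ρ : Representation k Γ M} {e : Module.Basis (H × B) k M} [Fintype (Γ ⧸ H)]

/-- Every element is fixed by the relative trace of some `H`-equivariant endomorphism. -/
def LocallyTrace (H : Subgroup Γ) [Fintype (Γ ⧸ H)] (ρ : Representation k Γ M) : Prop :=
  ∀ x, ∃ θ, IsEquivariantOn H ρ ρ θ ∧ relTrace H ρ ρ θ x = x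

/-- Enlarging the fixed submodule of a relative trace by finitely many elements, without changing
the map on that submodule. -/
theorem LocallyTrace.exists_enlarge (hloc : LocallyTrace H ρ) {θ : M →ₗ[k] M}
    (hθ : IsEquivariantOn H ρ ρ θ) (X : Finset M) :
    ∃ θ', IsEquivariantOn H ρ ρ θ' ∧
      (∀ x, relTrace H ρ ρ θ x = x → relTrace H ρ ρ θ' x = x ∧ θ' x = θ x) ∧
      ∀ x ∈ X, relTrace H ρ ρ θ' x = x := by
  classical
  induction X using Finset.induction_on with
  | empty => exact ⟨θ, hθ, fun x hx => ⟨hx, rfl⟩, by simp⟩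
  | insert y X _ ih =>
    obtain ⟨θ₁, h₁, hfix, hX⟩ := ih
    -- `ε` vanishes on what is already fixed. Being Γ-equivariant, it comes out of the trace of `θ₂
    -- ∘ₗ ε`, which therefore adds exactly the missing `ε y` at `y`.
    set ε : M →ₗ[k] M := LinearMap.id - relTrace H ρ ρ θ₁ with hε
    have hεe : IsEquivariantOn ⊤ ρ ρ ε := isEquivariantOn_id.sub (relTrace_isEquivariant h₁)
    obtain ⟨θ₂, h₂, hy⟩ := hloc (ε y)
    have key : relTrace H ρ ρ (θ₁ + θ₂ ∘ₗ ε) =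
        relTrace H ρ ρ θ₁ + relTrace H ρ ρ θ₂ ∘ₗ ε := by
      rw [relTrace_add, relTrace_comp hεe]
    have hker : ∀ x, relTrace H ρ ρ θ₁ x = x →
        relTrace H ρ ρ (θ₁ + θ₂ ∘ₗ ε) x = x ∧ (θ₁ + θ₂ ∘ₗ ε) x = θ₁ x := by
      intro x hx
      have : ε x = 0 := by simp [hε, hx]
      simp [key, this, hx]
    refine ⟨θ₁ + θ₂ ∘ₗ ε, h₁.add (h₂.comp (hεe.mono le_top)), fun x hx => ?_, fun x hx => ?_⟩
    · obtain ⟨a, b⟩ := hfix x hx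
      exact ⟨(hker x a).1, (hker x a).2.trans b⟩
    · rcases Finset.mem_insert.1 hx with rfl | hx
      · rw [key, LinearMap.add_apply, LinearMap.comp_apply, hy]
        simp [hε]
      · exact (hker x (hX x hx)).1

theorem coordSpan_le_fixed (he : IsFreeBasis ρ e) {S : Set B} {θ : M →ₗ[k] M}
    (hθ : IsEquivariantOn H ρ ρ θ) (hS : ∀ i ∈ S, relTrace H ρ ρ θ (e (1, i)) = e (1, i)) {x : M}
    (hx : x ∈ coordSpan e S) : relTrace H ρ ρ θ x = x :=
  eqOn_coordSpan he ((relTrace_isEquivariant hθ).mono le_top) isEquivariantOn_id hS hx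

/-- The coordinate subspace of `S` is stable under `Γ` and under the `H`-equivariant map
extending `f`, whose relative trace is the identity there. -/
structure IsPartialTrace (ρ : Representation k Γ M) (e : Module.Basis (H × B) k M) (S : Set B)
    (f : B → M) : Prop where
  stable : ∀ i ∈ S, ∀ γ, ρ γ (e (1, i)) ∈ coordSpan e S
  map_mem : ∀ i ∈ S, f i ∈ coordSpan e S
  fixed : ∀ i ∈ S, relTrace H ρ ρ (extendMap ρ e f) (e (1, i)) = e (1, i)

/-- The trace at `x` only evaluates the map on the Γ-orbit of `x`. -/
theorem relTrace_extendMap_eq (he : IsFreeBasis ρ e) {S : Set B} {θ : M →ₗ[k] M}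
    (hθ : IsEquivariantOn H ρ ρ θ) {f : B → M} (hf : ∀ i ∈ S, f i = θ (e (1, i))) {x : M}
    (hx : ∀ γ, ρ γ x ∈ coordSpan e S) :
    relTrace H ρ ρ (extendMap ρ e f) x = relTrace H ρ ρ θ x := by
  rw [relTrace_apply, relTrace_apply]
  refine Finset.sum_congr rfl fun g _ => ?_
  rw [eqOn_coordSpan he (extendMap_isEquivariantOn he f) hθ (S := S) (fun i hi => ?_) (hx _)]
  rw [extendMap_apply, hf i hi]
  simp

/-- Finitely many indices suffice for `T'`: up to `H` each basis element has one translate per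
coset, and every vector has finite support. The trace is then corrected on `T'`. -/
theorem exists_step [H.Normal] (he : IsFreeBasis ρ e) (hloc : LocallyTrace H ρ) (T : Finset B)
    {θ : M →ₗ[k] M} (hθ : IsEquivariantOn H ρ ρ θ) :
    ∃ (T' : Finset B) (θ' : M →ₗ[k] M), IsEquivariantOn H ρ ρ θ' ∧ T ⊆ T' ∧
      (∀ x, relTrace H ρ ρ θ x = x → relTrace H ρ ρ θ' x = x ∧ θ' x = θ x) ∧
      (∀ i ∈ T, (∀ γ, ρ γ (e (1, i)) ∈ coordSpan e (T' : Set B)) ∧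
        θ (e (1, i)) ∈ coordSpan e (T' : Set B)) ∧
      ∀ i ∈ T', relTrace H ρ ρ θ' (e (1, i)) = e (1, i) := by
  classical
  obtain ⟨T', hTT', hT'⟩ := exists_finset_coordSpan (e := e) T
    ((T.image fun i => θ (e (1, i))) ∪
      (T ×ˢ (Finset.univ : Finset (Γ ⧸ H))).image fun p => ρ p.2.out (e (1, p.1)))
  obtain ⟨θ', hθ', hfix, hX⟩ := hloc.exists_enlarge hθ (T'.image fun i => e (1, i))
  refine ⟨T', θ', hθ', hTT', hfix, fun i hi => ⟨fun γ => ?_, ?_⟩, fun i hi => ?_⟩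
  -- By normality `γ` and its representative `g` also differ by an element of `H` on the left, and
  -- coordinate subspaces are H-stable.
  · set g : Γ := ((γ : Γ ⧸ H)).out with hg
    have hmem : γ * g⁻¹ ∈ H := by
      have : g⁻¹ * γ ∈ H := QuotientGroup.eq.1 (by rw [hg, QuotientGroup.out_eq'])
      exact (inferInstance : H.Normal).mem_comm this
    have h2 : ρ γ (e (1, i)) = ρ ((⟨_, hmem⟩ : H) : Γ) (ρ g (e (1, i))) := by
      rw [← Module.End.mul_apply, ← map_mul]; simp
    rw [h2]
    refine map_mem_coordSpan he _ (hT' _ (Finset.mem_union_right _ ?_))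
    exact Finset.mem_image.2 ⟨(i, (γ : Γ ⧸ H)), by simp [hi], rfl⟩
  · exact hT' _ (Finset.mem_union_left _ (Finset.mem_image_of_mem _ hi))
  · exact hX _ (Finset.mem_image_of_mem _ hi)

theorem exists_step_sequence [H.Normal] (he : IsFreeBasis ρ e) (hloc : LocallyTrace H ρ)
    {θ₀ : M →ₗ[k] M} (h₀ : IsEquivariantOn H ρ ρ θ₀) (b : B) :
    ∃ (T : ℕ → Finset B) (θ : ℕ → M →ₗ[k] M), (∀ n, IsEquivariantOn H ρ ρ (θ n)) ∧
      b ∈ T 0 ∧ θ 0 = θ₀ ∧ (∀ n, T n ⊆ T (n + 1)) ∧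
      (∀ n x, relTrace H ρ ρ (θ n) x = x →
        relTrace H ρ ρ (θ (n + 1)) x = x ∧ θ (n + 1) x = θ n x) ∧
      (∀ n, ∀ i ∈ T n, (∀ γ, ρ γ (e (1, i)) ∈ coordSpan e (T (n + 1) : Set B)) ∧
        θ n (e (1, i)) ∈ coordSpan e (T (n + 1) : Set B)) ∧
      ∀ n, ∀ i ∈ T (n + 1), relTrace H ρ ρ (θ (n + 1)) (e (1, i)) = e (1, i) := by
  let State := {p : Finset B × (M →ₗ[k] M) // IsEquivariantOn H ρ ρ p.2}
  have hstep : ∀ s : State, ∃ s' : State, s.1.1 ⊆ s'.1.1 ∧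
      (∀ x, relTrace H ρ ρ s.1.2 x = x → relTrace H ρ ρ s'.1.2 x = x ∧ s'.1.2 x = s.1.2 x) ∧
      (∀ i ∈ s.1.1, (∀ γ, ρ γ (e (1, i)) ∈ coordSpan e (s'.1.1 : Set B)) ∧
        s.1.2 (e (1, i)) ∈ coordSpan e (s'.1.1 : Set B)) ∧
      ∀ i ∈ s'.1.1, relTrace H ρ ρ s'.1.2 (e (1, i)) = e (1, i) := by
    rintro ⟨⟨T, θ⟩, hθ⟩
    obtain ⟨T', θ', hθ', h⟩ := exists_step he hloc T hθ
    exact ⟨⟨⟨T', θ'⟩, hθ'⟩, h⟩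
  choose next h using hstep
  let s : ℕ → State := fun n => Nat.rec ⟨⟨{b}, θ₀⟩, h₀⟩ (fun _ t => next t) n
  exact ⟨fun n => (s n).1.1, fun n => (s n).1.2, fun n => (s n).2,
    Finset.mem_singleton_self b, rfl, fun n => (h (s n)).1, fun n => (h (s n)).2.1,
    fun n => (h (s n)).2.2.1, fun n => (h (s n)).2.2.2⟩

/-- A single step keeps neither Γ-stability nor stability under `θ`, since the new indices bring new
translates and values. The union of countably many steps is closed under both. -/
theorem IsPartialTrace.exists_extension [H.Normal] (he : IsFreeBasis ρ e)
    (hloc : LocallyTrace H ρ) {S : Set B} {f : B → M} (hS : IsPartialTrace ρ e S f) (b : B) :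
    ∃ S' f', IsPartialTrace ρ e S' f' ∧ S ⊆ S' ∧ b ∈ S' ∧ ∀ i ∈ S, f' i = f i := by
  classical
  set θ₀ := extendMap ρ e f with hθ₀
  have h₀ : IsEquivariantOn H ρ ρ θ₀ := extendMap_isEquivariantOn he f
  obtain ⟨T, θ, hθe, hb, h00, hsub, hfix, hclosed, hnew⟩ := exists_step_sequence he hloc h₀ b
  have hTmono : Monotone T := monotone_nat_of_le_succ hsub
  have hS0fix : ∀ i ∈ S, relTrace H ρ ρ (θ 0) (e (1, i)) = e (1, i) := fun i hi =>
    h00 ▸ hS.fixed i hi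
  have hfixle : ∀ m n, m ≤ n → ∀ x, relTrace H ρ ρ (θ m) x = x →
      relTrace H ρ ρ (θ n) x = x ∧ θ n x = θ m x := by
    intro m n hmn x hx
    induction n, hmn using Nat.le_induction with
    | base => exact ⟨hx, rfl⟩
    | succ n _ ih =>
      obtain ⟨a, c⟩ := hfix n x ih.1
      exact ⟨a, c.trans ih.2⟩
  -- `U n` is paired with `θ (n + 1)`, since the trace of `θ 0` need not fix the basis element
  -- indexed by `b`, which already lies in `T 0`.
  let U : ℕ → Set B := fun n => S ∪ T n
  have hUmono : Monotone U := fun m n h => Set.union_subset_union_right _ (hTmono h)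
  have hUfix : ∀ n, ∀ i ∈ U n, relTrace H ρ ρ (θ (n + 1)) (e (1, i)) = e (1, i) := by
    rintro n i (hi | hi)
    · exact (hfixle 0 (n + 1) (Nat.zero_le _) _ (hS0fix i hi)).1
    · exact hnew n i (hTmono (Nat.le_succ n) hi)
  have hS0 : ∀ n, ∀ i ∈ S, θ n (e (1, i)) = f i := by
    intro n i hi
    rw [(hfixle 0 n (Nat.zero_le _) _ (hS0fix i hi)).2, h00, hθ₀, extendMap_apply]
    simp
  let S' : Set B := ⋃ n, U n
  have hex : ∀ i, ∃ y, ∀ n, i ∈ U n → y = θ (n + 1) (e (1, i)) := by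
    intro i
    by_cases h : ∃ n, i ∈ U n
    · refine ⟨θ (Nat.find h + 1) (e (1, i)), fun n hn => ?_⟩
      exact ((hfixle (Nat.find h + 1) (n + 1) (by have := Nat.find_min' h hn; omega) _
        (hUfix _ i (Nat.find_spec h))).2).symm
    · exact ⟨0, fun n hn => (h ⟨n, hn⟩).elim⟩
  choose f' hf' using hex
  have hUstable : ∀ n, ∀ i ∈ U n, ∀ γ, ρ γ (e (1, i)) ∈ coordSpan e (U (n + 1)) := by
    rintro n i (hi | hi) γ
    · exact coordSpan_mono Set.subset_union_left (hS.stable i hi γ)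
    · exact coordSpan_mono Set.subset_union_right ((hclosed n i hi).1 γ)
  refine ⟨S', f', ⟨fun i hi γ => ?_, fun i hi => ?_, fun i hi => ?_⟩,
    Set.subset_union_left.trans (Set.subset_iUnion U 0),
    Set.mem_iUnion.2 ⟨0, Or.inr hb⟩, fun i hi => ?_⟩
  · obtain ⟨n, hn⟩ := Set.mem_iUnion.1 hi
    exact coordSpan_mono (Set.subset_iUnion U _) (hUstable n i hn γ)
  · obtain ⟨n, hn⟩ := Set.mem_iUnion.1 hi
    rw [hf' i n hn]
    rcases hn with hn | hn
    · rw [hS0 _ i hn]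
      exact coordSpan_mono (Set.subset_union_left.trans (Set.subset_iUnion U 0)) (hS.map_mem i hn)
    · have h1 := (hclosed (n + 1) i (hTmono (Nat.le_succ n) hn)).2
      exact coordSpan_mono (Set.subset_union_right.trans (Set.subset_iUnion U (n + 2))) h1
  · obtain ⟨n, hn⟩ := Set.mem_iUnion.1 hi
    -- The orbit of `e (1, i)` reaches into `U (n + 1)`, where `f'` is given by `θ (n + 2)`.
    rw [relTrace_extendMap_eq he (hθe (n + 2)) (S := U (n + 1)) (fun j hj => hf' j _ hj)
      (hUstable n i hn)]
    exact hUfix _ i (hUmono (Nat.le_succ n) hn)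
  · rw [hf' i 0 (Or.inl hi), hS0 _ i hi]

/-- Zorn's lemma for partial traces ordered by extension: chains glue, and a maximal element
contains every index by `IsPartialTrace.exists_extension`. -/
theorem LocallyTrace.exists_relTrace_eq_id [H.Normal] (he : IsFreeBasis ρ e)
    (hloc : LocallyTrace H ρ) :
    ∃ θ, IsEquivariantOn H ρ ρ θ ∧ relTrace H ρ ρ θ = LinearMap.id := by
  classical
  let P := {p : Set B × (B → M) // IsPartialTrace ρ e p.1 p.2}
  let r : P → P → Prop := fun p q => p.1.1 ⊆ q.1.1 ∧ ∀ i ∈ p.1.1, q.1.2 i = p.1.2 i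
  have rtrans : ∀ {a b c : P}, r a b → r b c → r a c := fun {a b c} h h' =>
    ⟨h.1.trans h'.1, fun i hi => (h'.2 i (h.1 hi)).trans (h.2 i hi)⟩
  obtain ⟨m, hm⟩ := exists_maximal_of_chains_bounded (r := r) (fun c hc => by
    let S : Set B := ⋃ p ∈ c, p.1.1
    have hex : ∀ i, ∃ y, ∀ p ∈ c, i ∈ p.1.1 → y = p.1.2 i := by
      intro i
      by_cases h : ∃ p ∈ c, i ∈ p.1.1
      · obtain ⟨p, hp, hi⟩ := h
        refine ⟨p.1.2 i, fun q hq hiq => ?_⟩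
        rcases eq_or_ne p q with rfl | hne
        · rfl
        rcases hc hp hq hne with h | h
        · exact (h.2 i hi).symm
        · exact h.2 i hiq
      -- Outside the union the glued function takes the irrelevant value `0`.
      · exact ⟨0, fun p hp hi => (h ⟨p, hp, hi⟩).elim⟩
    choose f hf using hex
    have hle : ∀ p ∈ c, p.1.1 ⊆ S := fun p hp => Set.subset_biUnion_of_mem (u := fun p : P => p.1.1) hp
    refine ⟨⟨(S, f), ⟨fun i hi γ => ?_, fun i hi => ?_, fun i hi => ?_⟩⟩, fun p hp =>
      ⟨hle p hp, fun i hi => hf i p hp hi⟩⟩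
    · obtain ⟨p, hp, hi⟩ := Set.mem_iUnion₂.1 hi
      exact coordSpan_mono (hle p hp) (p.2.stable i hi γ)
    · obtain ⟨p, hp, hi⟩ := Set.mem_iUnion₂.1 hi
      rw [show (S, f).2 i = p.1.2 i from hf i p hp hi]
      exact coordSpan_mono (hle p hp) (p.2.map_mem i hi)
    · obtain ⟨p, hp, hi⟩ := Set.mem_iUnion₂.1 hi
      refine (relTrace_extendMap_eq he (extendMap_isEquivariantOn he p.1.2) (S := p.1.1)
        (fun j hj => ?_) (p.2.stable i hi)).trans (p.2.fixed i hi)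
      rw [extendMap_apply, show (S, f).2 j = p.1.2 j from hf j p hp hj]
      simp) rtrans
  have huniv : ∀ b, b ∈ m.1.1 := by
    intro b
    obtain ⟨S', f', h, hS, hb, hf⟩ := m.2.exists_extension he hloc b
    exact (hm ⟨(S', f'), h⟩ ⟨hS, hf⟩).1 hb
  refine ⟨extendMap ρ e m.1.2, extendMap_isEquivariantOn he _, LinearMap.ext fun x => ?_⟩
  refine coordSpan_le_fixed he (extendMap_isEquivariantOn he _) (S := Set.univ)
    (fun i _ => m.2.fixed i (huniv i)) ?_
  rw [coordSpan_univ]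
  trivial

end LocalToGlobal

/-! ### Submodules of free modules over a principal ideal domain. -/

section SubmoduleFree

/-- A submodule of a free module of arbitrary rank over a principal ideal domain is free. -/
theorem Submodule.free_of_finsupp {R ι : Type*} [CommRing R] [IsDomain R] [IsPrincipalIdealRing R]
    [LinearOrder ι] [WellFoundedLT ι] (N : Submodule R (ι →₀ R)) : Module.Free R N := by
  classical
  -- `I i` is the ideal of leading coefficients at `i`. Elements `x i` realising its generators,
  -- where nonzero, form a triangular basis; spanning is well-founded induction on the leading
  -- index.
  let F : ι → Submodule R (ι →₀ R) := fun i => N ⊓ Finsupp.supported R R (Set.Iic i)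
  let I : ι → Ideal R := fun i => (F i).map (Finsupp.lapply i)
  have hx : ∀ i, ∃ x ∈ F i, x i = Submodule.IsPrincipal.generator (I i) := fun i =>
    Submodule.mem_map.1 (Submodule.IsPrincipal.generator_mem (I i))
  choose x hxF hxi using hx
  have hzero : ∀ i j, i < j → x i j = 0 := by
    intro i j hij
    by_contra h
    exact absurd ((Finsupp.mem_supported R _).1 (hxF i).2 (Finsupp.mem_support_iff.2 h))
      (by simpa using hij)
  let J := {i // x i i ≠ 0}
  let v : J → N := fun j => ⟨x j, (hxF j).1⟩
  have hli : LinearIndependent R v := by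
    refine LinearIndependent.of_comp N.subtype (linearIndependent_iff.2 fun l hl => ?_)
    by_contra hne
    have hs : l.support.Nonempty := Finsupp.support_nonempty_iff.2 hne
    set j := l.support.max' hs with hj
    have h1 : Finsupp.linearCombination R (N.subtype ∘ v) l j = l j * x j j := by
      rw [Finsupp.linearCombination_apply, Finsupp.sum, Finsupp.finsetSum_apply, Finset.sum_eq_single j]
      · simp [v]
      · intro k hk hkj
        have : k < j := lt_of_le_of_ne (Finset.le_max' _ _ hk) hkj
        simp [v, hzero k j this]
      · intro h
        exact absurd (Finset.max'_mem _ hs) h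
    rw [hl] at h1
    have h2 : l j ≠ 0 := Finsupp.mem_support_iff.1 (Finset.max'_mem _ hs)
    exact mul_ne_zero h2 j.2 (by simpa using h1.symm)
  have hspan : ∀ i, ∀ y : N, (y : ι →₀ R) ∈ F i → y ∈ Submodule.span R (Set.range v) := by
    intro i
    induction i using WellFoundedLT.induction with
    | ind i ih =>
      intro y hy
      have hyI : (y : ι →₀ R) i ∈ I i := Submodule.mem_map.2 ⟨_, hy, rfl⟩
      obtain ⟨a, ha⟩ := (Submodule.IsPrincipal.mem_iff_eq_smul_generator (I i)).1 hyI
      rw [← hxi] at ha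
      set z : N := y - a • ⟨x i, (hxF i).1⟩ with hz
      have hzF : (z : ι →₀ R) ∈ F i := (F i).sub_mem hy ((F i).smul_mem a (hxF i))
      have hzi : (z : ι →₀ R) i = 0 := by simp [hz, ha]
      -- If the generator is zero then `x i` is not in the family, but then `y` has no coefficient
      -- at `i` and needs no correction.
      have hxs : (⟨x i, (hxF i).1⟩ : N) ∈ Submodule.span R (Set.range v) ∨ a • x i i = 0 := by
        by_cases h : x i i = 0
        · right; simp [h]
        · left; exact Submodule.subset_span ⟨⟨i, h⟩, rfl⟩
      have hzs : ∀ z' : N, (z' : ι →₀ R) ∈ F i → (z' : ι →₀ R) i = 0 →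
          z' ∈ Submodule.span R (Set.range v) := by
        intro z' hzF hzi
        by_cases hne : (z' : ι →₀ R) = 0
        · rw [show z' = 0 from Subtype.ext hne]
          exact zero_mem _
        have hs : (z' : ι →₀ R).support.Nonempty := Finsupp.support_nonempty_iff.2 hne
        have hmem := Finset.max'_mem _ hs
        refine ih ((z' : ι →₀ R).support.max' hs) (lt_of_le_of_ne ?_ ?_) z' ⟨z'.2, ?_⟩
        · exact (Finsupp.mem_supported R _).1 hzF.2 hmem
        · intro h
          rw [h, Finsupp.mem_support_iff] at hmem
          exact hmem hzi
        · exact (Finsupp.mem_supported R _).2 fun k hk => Finset.le_max' _ _ hk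
      rcases hxs with h | h
      · have : y = z + a • ⟨x i, (hxF i).1⟩ := by rw [hz]; abel
        rw [this]
        exact add_mem (hzs z hzF hzi) (Submodule.smul_mem _ _ h)
      · exact hzs y hy (by rw [ha, h])
  refine Module.Free.of_basis (Module.Basis.mk hli ?_)
  rintro y -
  by_cases hne : (y : ι →₀ R) = 0
  · rw [show y = 0 from Subtype.ext hne]
    exact zero_mem _
  have hs : (y : ι →₀ R).support.Nonempty := Finsupp.support_nonempty_iff.2 hne
  exact hspan ((y : ι →₀ R).support.max' hs) y ⟨y.2, (Finsupp.mem_supported R _).2 fun k hk => Finset.le_max' _ _ hk⟩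

theorem Submodule.free_of_isPrincipalIdealRing {R V : Type*} [CommRing R] [IsDomain R]
    [IsPrincipalIdealRing R] [AddCommGroup V] [Module R V] [Module.Free R V] (N : Submodule R V) :
    Module.Free R N := by
  classical
  let b := Module.Free.chooseBasis R V
  let := WellOrderingRel.isWellOrder (α := Module.Free.ChooseBasisIndex R V)
  let : LinearOrder (Module.Free.ChooseBasisIndex R V) := linearOrderOfSTO WellOrderingRel
  have : WellFoundedLT (Module.Free.ChooseBasisIndex R V) := ⟨WellOrderingRel.isWellOrder.wf⟩
  have := Submodule.free_of_finsupp (N.map b.repr.toLinearMap)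
  exact Module.Free.of_equiv (b.repr.submoduleMap N).symm

end SubmoduleFree

/-! ### Untwisting a diagonal action. -/

section TensorFree

variable {k Γ : Type*} [CommRing k] [Group Γ] {M A : Type*} [AddCommMonoid M] [AddCommMonoid A]
  [Module k M] [Module k A] {H : Subgroup Γ}
  {B : Type*} {ρ : Representation k Γ M} {e : Module.Basis (H × B) k M}

open TensorProduct

/-- The tensor product of a `k`-free representation with an `H`-free one is `H`-free. -/
theorem exists_isFreeBasis_tprod {J : Type*} (α : Representation k Γ A) (b : Module.Basis J k A)
    (he : IsFreeBasis ρ e) :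
    ∃ e' : Module.Basis (H × (J × B)) k (A ⊗[k] M), IsFreeBasis (α.tprod ρ) e' := by
  have hex : ∀ f : H → (A →ₗ[k] A), ∃ t : A ⊗[k] M →ₗ[k] A ⊗[k] M,
      ∀ a p, t (a ⊗ₜ e p) = f p.1 a ⊗ₜ e p := fun f =>
    ⟨TensorProduct.lift (LinearMap.flip (e.constr k fun p =>
      (LinearMap.flip (TensorProduct.mk k A M) (e p)) ∘ₗ f p.1)), fun a p => by simp⟩
  choose twist htwist using hex
  have hcomp : ∀ f g : H → (A →ₗ[k] A), (∀ h a, f h (g h a) = a) →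
      twist f ∘ₗ twist g = LinearMap.id := by
    intro f g hfg
    refine TensorProduct.ext (LinearMap.ext fun a => e.ext fun p => ?_)
    simp [htwist, hfg]
  -- `a ⊗ h e_i ↦ h a ⊗ h e_i` turns the action of `H` on the second factor alone into the diagonal
  -- one.
  let T : A ⊗[k] M ≃ₗ[k] A ⊗[k] M := LinearEquiv.ofLinearMap (twist fun h => α h)
    (twist fun h => α (h : Γ)⁻¹) (hcomp (fun h => α h) (fun h => α (h : Γ)⁻¹) fun h a => by simp)
    (hcomp (fun h => α (h : Γ)⁻¹) (fun h => α h) fun h a => by simp)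
  have hT : ∀ a p, T (a ⊗ₜ e p) = α (p.1 : Γ) a ⊗ₜ e p := htwist _
  refine ⟨((b.tensorProduct e).map T).reindex
    ⟨fun p => (p.2.1, p.1, p.2.2), fun p => (p.2.1, p.1, p.2.2), fun _ => rfl, fun _ => rfl⟩, ?_⟩
  rintro h h' ⟨j, i⟩
  simp [hT, he h h' i, Module.Basis.tensorProduct_apply]

end TensorFree

/-! ### The embedding of `M` into the free kΓ-module on its kH-basis. -/

section RegularModule

variable {k Γ : Type*} [CommRing k] [Group Γ] {M : Type*} [AddCommMonoid M] [Module k M]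
  {H : Subgroup Γ} {B : Type*} {ρ : Representation k Γ M} {e : Module.Basis (H × B) k M}

/-- The action of `Γ` on `Γ →₀ k` by `γ • δ = δ γ⁻¹`. -/
noncomputable def rightTranslation (k Γ : Type*) [CommRing k] [Group Γ] :
    Representation k Γ (Γ →₀ k) where
  toFun γ := Finsupp.lmapDomain k k (· * γ⁻¹)
  map_one' := by ext; simp
  map_mul' a b := by ext; simp [mul_assoc]

/-- The action of `Γ` on `B →₀ Γ →₀ k` by left translation on `Γ`. -/
noncomputable def leftTranslation (k Γ B : Type*) [CommRing k] [Group Γ] :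
    Representation k Γ (B →₀ Γ →₀ k) where
  toFun γ := Finsupp.mapRange.linearMap (Finsupp.lmapDomain k k (γ * ·))
  map_one' := by ext; simp
  map_mul' a b := by ext; simp [mul_assoc]

theorem rightTranslation_single (γ δ : Γ) (c : k) :
    rightTranslation k Γ γ (Finsupp.single δ c) = Finsupp.single (δ * γ⁻¹) c := by
  simp [rightTranslation]

theorem leftTranslation_single_single (γ δ : Γ) (i : B) (c : k) :
    leftTranslation k Γ B γ (Finsupp.single i (Finsupp.single δ c)) =
      Finsupp.single i (Finsupp.single (γ * δ) c) := by
  simp [leftTranslation]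

/-- The embedding of a module with a free `kH`-basis into the free `kΓ`-module with the same
basis. -/
noncomputable def toRegular (e : Module.Basis (H × B) k M) : M →ₗ[k] B →₀ Γ →₀ k :=
  extendMap (leftTranslation k Γ B) e fun i => Finsupp.single i (Finsupp.single 1 1)

theorem toRegular_basis (h : H) (i : B) :
    toRegular e (e (h, i)) = Finsupp.single i (Finsupp.single (h : Γ) 1) := by
  rw [toRegular, extendMap_apply, leftTranslation_single_single, mul_one]

theorem toRegular_isEquivariantOn (he : IsFreeBasis ρ e) :
    IsEquivariantOn H ρ (leftTranslation k Γ B) (toRegular e) :=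
  extendMap_isEquivariantOn he _

/-- The product `(a, m) ↦ a • toRegular e m`. -/
noncomputable def smulToRegular (e : Module.Basis (H × B) k M) :
    (Γ →₀ k) →ₗ[k] M →ₗ[k] B →₀ Γ →₀ k :=
  Finsupp.linearCombination k fun γ => leftTranslation k Γ B γ ∘ₗ toRegular e

theorem smulToRegular_single (γ : Γ) (m : M) :
    smulToRegular e (Finsupp.single γ 1) m = leftTranslation k Γ B γ (toRegular e m) := by
  simp [smulToRegular]

theorem smulToRegular_basis (a : Γ →₀ k) (h : H) (i : B) :
    smulToRegular e a (e (h, i)) = Finsupp.single i (rightTranslation k Γ (h : Γ)⁻¹ a) := by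
  have : (smulToRegular e).flip (e (h, i)) =
      Finsupp.lsingle i ∘ₗ rightTranslation k Γ (h : Γ)⁻¹ := by
    ext1 γ
    ext1
    simp only [LinearMap.comp_apply, LinearMap.flip_apply, Finsupp.lsingle_apply]
    rw [smulToRegular_single, toRegular_basis, leftTranslation_single_single,
      rightTranslation_single, inv_inv]
  exact LinearMap.congr_fun this a

/-- The action `(a, m) ↦ a • m` of finitely supported functions on a representation. -/
noncomputable def groupAlgebraAction (ρ : Representation k Γ M) :
    (Γ →₀ k) →ₗ[k] M →ₗ[k] M :=
  Finsupp.linearCombination k fun γ => ρ γ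

theorem groupAlgebraAction_single (γ : Γ) (m : M) :
    groupAlgebraAction ρ (Finsupp.single γ 1) m = ρ γ m := by
  simp [groupAlgebraAction]

theorem groupAlgebraAction_rightTranslation (γ : Γ) (a : Γ →₀ k) (m : M) :
    groupAlgebraAction ρ (rightTranslation k Γ γ a) m = groupAlgebraAction ρ a (ρ γ⁻¹ m) := by
  have : (groupAlgebraAction ρ).flip m ∘ₗ rightTranslation k Γ γ =
      (groupAlgebraAction ρ).flip (ρ γ⁻¹ m) := by
    ext δ
    simp only [LinearMap.comp_apply, LinearMap.flip_apply, Finsupp.lsingle_apply]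
    rw [rightTranslation_single, groupAlgebraAction_single, groupAlgebraAction_single, map_mul,
      Module.End.mul_apply]
  exact LinearMap.congr_fun this a

/-- Evaluation at the `i`-th coordinate followed by the action on `m`. -/
noncomputable def coordAction (ρ : Representation k Γ M) (i : B) (m : M) :
    (B →₀ Γ →₀ k) →ₗ[k] M :=
  (groupAlgebraAction ρ).flip m ∘ₗ Finsupp.lapply i

theorem coordAction_isEquivariant (i : B) (m : M) :
    IsEquivariantOn ⊤ (leftTranslation k Γ B) ρ (coordAction ρ i m) := by
  classical
  intro γ _ y
  have : coordAction ρ i m ∘ₗ leftTranslation k Γ B γ = ρ γ ∘ₗ coordAction ρ i m := by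
    ext j δ
    simp only [LinearMap.comp_apply, Finsupp.lsingle_apply, coordAction, LinearMap.flip_apply,
      Finsupp.lapply_apply]
    rw [leftTranslation_single_single]
    by_cases h : j = i
    · subst h
      rw [Finsupp.single_eq_same, Finsupp.single_eq_same, groupAlgebraAction_single,
        groupAlgebraAction_single, map_mul, Module.End.mul_apply]
    · simp [h]
  exact LinearMap.congr_fun this y

/-- The `H`-equivariant map from the free `kΓ`-module sending `γ • i` to `γ • b i` for `γ ∈ H` and
to `0` for `γ ∉ H`. -/
noncomputable def fromFreeOn (H : Subgroup Γ) (ρ : Representation k Γ M) (b : B → M) :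
    (B →₀ Γ →₀ k) →ₗ[k] M := by
  classical
  exact Finsupp.lsum k fun i => Finsupp.linearCombination k fun γ =>
    if γ ∈ H then ρ γ (b i) else 0

theorem fromFreeOn_leftTranslation [DecidablePred (· ∈ H)] (he : IsFreeBasis ρ e) (γ : Γ)
    (m : M) : fromFreeOn H ρ (fun i => e (1, i)) (leftTranslation k Γ B γ (toRegular e m)) =
      if γ ∈ H then ρ γ m else 0 := by
  have : fromFreeOn H ρ (fun i => e (1, i)) ∘ₗ leftTranslation k Γ B γ ∘ₗ toRegular e =
      if γ ∈ H then ρ γ else 0 := by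
    refine e.ext fun p => ?_
    obtain ⟨h, i⟩ := p
    simp only [LinearMap.comp_apply]
    rw [toRegular_basis, leftTranslation_single_single]
    by_cases hγ : γ ∈ H
    · have h2 : γ * h ∈ H := H.mul_mem hγ h.2
      rw [he.eq h i]
      simp [fromFreeOn, hγ, h2]
    · have h2 : γ * h ∉ H := fun h' => hγ ((H.mul_mem_cancel_right h.2).1 h')
      simp [fromFreeOn, hγ, h2]
  rw [← LinearMap.comp_apply, ← LinearMap.comp_apply, LinearMap.comp_assoc, this]
  split_ifs <;> rfl

variable [Fintype (Γ ⧸ H)]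

/-- In `∑ g ⊗ g⁻¹x` only the trivial coset is supported on `H`, and its term recovers `x`. -/
theorem fromFreeOn_relTrace (he : IsFreeBasis ρ e) (x : M) :
    fromFreeOn H ρ (fun i => e (1, i)) (relTrace H ρ (leftTranslation k Γ B) (toRegular e) x) = x := by
  classical
  rw [relTrace_apply, map_sum, Finset.sum_eq_single ((1 : Γ) : Γ ⧸ H)]
  · rw [fromFreeOn_leftTranslation he, if_pos]
    · simp
    · have := QuotientGroup.eq.1 (QuotientGroup.out_eq' ((1 : Γ) : Γ ⧸ H))
      simpa using this
  · intro g _ hg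
    rw [fromFreeOn_leftTranslation he, if_neg]
    intro h
    refine hg ?_
    rw [← QuotientGroup.out_eq' g]
    exact QuotientGroup.eq.2 (by simpa using h)
  · simp

theorem relTrace_toRegular_injective (he : IsFreeBasis ρ e) :
    Function.Injective (relTrace H ρ (leftTranslation k Γ B) (toRegular e)) :=
  Function.LeftInverse.injective (fromFreeOn_relTrace he)

/-- The norm of `a ⊗ m` in the H-coinvariants is the image of `a m`. For `a = γ` the elements `γ
g⁻¹` again represent all cosets, by normality. -/
theorem sum_smulToRegular [H.Normal] (he : IsFreeBasis ρ e) (a : Γ →₀ k) (m : M) :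
    ∑ g : Γ ⧸ H, smulToRegular e (rightTranslation k Γ g.out a) (ρ g.out m) =
      relTrace H ρ (leftTranslation k Γ B) (toRegular e) (groupAlgebraAction ρ a m) := by
  have : ∑ g : Γ ⧸ H, (smulToRegular e).flip (ρ g.out m) ∘ₗ rightTranslation k Γ g.out =
      relTrace H ρ (leftTranslation k Γ B) (toRegular e) ∘ₗ (groupAlgebraAction ρ).flip m := by
    ext1 γ
    ext1
    simp only [LinearMap.comp_apply, LinearMap.flip_apply, Finsupp.lsingle_apply,
      LinearMap.sum_apply]
    rw [groupAlgebraAction_single, ← sum_eq_relTrace (toRegular_isEquivariantOn he)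
      ((Equiv.inv (Γ ⧸ H)).trans (Equiv.mulLeft (γ : Γ ⧸ H))) (fun g => γ * g.out⁻¹)
      (fun g => by simp)]
    refine Finset.sum_congr rfl fun g _ => ?_
    rw [rightTranslation_single, smulToRegular_single, ← Module.End.mul_apply, ← map_mul]
    congr 5
    group
  simpa using LinearMap.congr_fun this a

/-- Right multiplication by `γ⁻¹` combined with the action of `γ` fixes the elements
`relTrace (toRegular e) x`. -/
theorem lsum_smulToRegular_relTrace [H.Normal] (he : IsFreeBasis ρ e) (γ : Γ) (x : M) :
    (Finsupp.lsum k fun i => (smulToRegular e).flip (ρ γ (e (1, i))) ∘ₗ rightTranslation k Γ γ)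
      (relTrace H ρ (leftTranslation k Γ B) (toRegular e) x) =
      relTrace H ρ (leftTranslation k Γ B) (toRegular e) x := by
  set t : (B →₀ Γ →₀ k) →ₗ[k] (B →₀ Γ →₀ k) := Finsupp.lsum k fun i =>
    (smulToRegular e).flip (ρ γ (e (1, i))) ∘ₗ rightTranslation k Γ γ with ht
  have key : ∀ (g : Γ) (m : M), t (leftTranslation k Γ B g (toRegular e m)) =
      leftTranslation k Γ B (g * γ⁻¹) (toRegular e (ρ γ m)) := by
    intro g m
    have : t ∘ₗ leftTranslation k Γ B g ∘ₗ toRegular e =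
        leftTranslation k Γ B (g * γ⁻¹) ∘ₗ toRegular e ∘ₗ ρ γ := by
      refine e.ext fun p => ?_
      obtain ⟨h, i⟩ := p
      have hconj : γ * h * γ⁻¹ ∈ H := (inferInstance : H.Normal).conj_mem _ h.2 _
      have h1 : ρ γ (e (h, i)) = ρ (γ * h * γ⁻¹) (ρ γ (e (1, i))) := by
        rw [he.eq, ← Module.End.mul_apply, ← Module.End.mul_apply, ← map_mul, ← map_mul]
        simp
      simp only [LinearMap.comp_apply]
      rw [toRegular_basis, leftTranslation_single_single, h1,
        toRegular_isEquivariantOn he _ hconj, ← Module.End.mul_apply, ← map_mul, ht,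
        Finsupp.lsum_single, LinearMap.comp_apply, rightTranslation_single, LinearMap.flip_apply,
        smulToRegular_single]
      congr 2
      group
    exact LinearMap.congr_fun this m
  rw [relTrace_apply, map_sum, ← relTrace_apply, ← sum_eq_relTrace
    (toRegular_isEquivariantOn he) (Equiv.mulRight ((γ⁻¹ : Γ) : Γ ⧸ H)) (fun g => g.out * γ⁻¹)
    (fun g => by simp)]
  refine Finset.sum_congr rfl fun g _ => ?_
  rw [key, ← Module.End.mul_apply (ρ γ), ← map_mul]
  congr 4
  group

end RegularModule

/-! ### Pointwise traces from norms in coinvariants. -/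

section LocalTrace

open TensorProduct Representation

/-- Every class in the `H`-coinvariants which is invariant under `Γ` is a norm from the
`H`-coinvariants. -/
def CoinvariantsAreNorms {k Γ M : Type*} [CommRing k] [Group Γ] [AddCommGroup M] [Module k M]
    (H : Subgroup Γ) [Fintype (Γ ⧸ H)] (ρ : Representation k Γ M) : Prop :=
  ∀ w, (∀ γ, ρ γ w - w ∈ Coinvariants.ker (ρ.comp H.subtype)) →
    ∃ v, w - ∑ g : Γ ⧸ H, ρ g.out v ∈ Coinvariants.ker (ρ.comp H.subtype)

variable {k : Type w} {Γ : Type v} [CommRing k] [Group Γ] {M : Type*} [AddCommGroup M] [Module k M]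
  {H : Subgroup Γ} {B : Type*} {ρ : Representation k Γ M} {e : Module.Basis (H × B) k M}
  {A : Type*} [AddCommGroup A] [Module k A] {α : Representation k Γ A} {j : A →ₗ[k] Γ →₀ k}

/-- This is the chain (A ⊗ M)_H ≅ A ⊗_{kH} M ≅ A^(B) ⊆ (kΓ)^(B), with `H` acting on the right ideal
`A` through inverses. -/
theorem exists_tprod_toFinsupp (he : IsFreeBasis ρ e) (hj : Function.Injective j)
    (hα : ∀ γ a, j (α γ a) = rightTranslation k Γ γ (j a)) :
    ∃ D : A ⊗[k] M →ₗ[k] (B →₀ Γ →₀ k),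
      (∀ a m, D (a ⊗ₜ m) = smulToRegular e (j a) m) ∧
      ∀ w, w ∈ Coinvariants.ker ((α.tprod ρ).comp H.subtype) ↔ D w = 0 := by
  let D' : A ⊗[k] M →ₗ[k] (B →₀ A) := TensorProduct.lift (LinearMap.flip (e.constr k fun p =>
    Finsupp.lsingle p.2 ∘ₗ α (p.1 : Γ)⁻¹))
  have hD' : ∀ a h i, D' (a ⊗ₜ e (h, i)) = Finsupp.single i (α (h : Γ)⁻¹ a) := by
    intro a h i
    simp [D']
  let incl : (B →₀ A) →ₗ[k] (B →₀ Γ →₀ k) := Finsupp.mapRange.linearMap j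
  have hincl : Function.Injective incl := by
    intro x y hxy
    ext1 i
    exact hj (by simpa [incl] using DFunLike.congr_fun hxy i)
  have hD : ∀ a m, (incl ∘ₗ D') (a ⊗ₜ m) = smulToRegular e (j a) m := by
    intro a m
    have : incl ∘ₗ D' ∘ₗ TensorProduct.mk k A M a = smulToRegular e (j a) := by
      refine e.ext fun p => ?_
      obtain ⟨h, i⟩ := p
      simp only [LinearMap.comp_apply, TensorProduct.mk_apply]
      rw [hD', smulToRegular_basis]
      simp [incl, hα]
    exact LinearMap.congr_fun this m
  refine ⟨incl ∘ₗ D', hD, fun w => ⟨fun hw => ?_, fun hw => ?_⟩⟩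
  · have hinv : ∀ h : H, D' ∘ₗ (α.tprod ρ) h = D' := by
      intro h
      refine TensorProduct.ext (LinearMap.ext fun a => e.ext fun p => ?_)
      obtain ⟨h', i⟩ := p
      simp [hD', he h h' i, ← Module.End.mul_apply, ← map_mul, mul_assoc]
    have hle : Coinvariants.ker ((α.tprod ρ).comp H.subtype) ≤ LinearMap.ker D' := by
      rw [Coinvariants.ker, Submodule.span_le]
      rintro _ ⟨⟨h, x⟩, rfl⟩
      simpa [sub_eq_zero] using LinearMap.congr_fun (hinv h) x
    rw [LinearMap.comp_apply, LinearMap.mem_ker.1 (hle hw), map_zero]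
  · have hw' : D' w = 0 := hincl (by simpa using hw)
    -- `t` inverts `D'` modulo the kernel, because `a ⊗ h e_i` and `h⁻¹a ⊗ e_i` have the same class.
    let t : (B →₀ A) →ₗ[k] A ⊗[k] M := Finsupp.lsum k fun i =>
      (TensorProduct.mk k A M).flip (e (1, i))
    have key : (Coinvariants.ker ((α.tprod ρ).comp H.subtype)).mkQ ∘ₗ t ∘ₗ D' =
        (Coinvariants.ker ((α.tprod ρ).comp H.subtype)).mkQ := by
      refine TensorProduct.ext (LinearMap.ext fun a => e.ext fun p => ?_)
      obtain ⟨h, i⟩ := p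
      change Submodule.Quotient.mk (t (D' (a ⊗ₜ e (h, i)))) = Submodule.Quotient.mk (a ⊗ₜ e (h, i))
      rw [Submodule.Quotient.eq]
      refine Coinvariants.mem_ker_of_eq h⁻¹ (a ⊗ₜ e (h, i)) _ ?_
      rw [hD', he.eq h i]
      simp [t]
    have := LinearMap.congr_fun key w
    rw [LinearMap.comp_apply, LinearMap.comp_apply, hw', map_zero, map_zero] at this
    exact (Submodule.Quotient.mk_eq_zero _).1 this.symm

/-- The right ideal generated by the coordinates of `ξ`. -/
noncomputable def coordIdeal (ξ : B →₀ Γ →₀ k) : Submodule k (Γ →₀ k) :=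
  Submodule.span k (Set.range fun p : Γ × B => rightTranslation k Γ p.1 (ξ p.2))

theorem coordIdeal_le_comap (ξ : B →₀ Γ →₀ k) (γ : Γ) :
    coordIdeal ξ ≤ (coordIdeal ξ).comap (rightTranslation k Γ γ) := by
  conv_lhs => rw [coordIdeal]
  rw [Submodule.span_le]
  rintro _ ⟨⟨δ, i⟩, rfl⟩
  refine Submodule.subset_span ⟨(γ * δ, i), ?_⟩
  simp

theorem coord_mem_coordIdeal (ξ : B →₀ Γ →₀ k) (i : B) : ξ i ∈ coordIdeal ξ :=
  Submodule.subset_span ⟨(1, i), by simp⟩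

theorem relTrace_smul {N : Type*} [AddCommMonoid N] [Module k N] [Fintype (Γ ⧸ H)]
    {σ : Representation k Γ N} (c : k) (θ : M →ₗ[k] N) :
    relTrace H ρ σ (c • θ) = c • relTrace H ρ σ θ := by
  ext x
  simp [relTrace_apply, Finset.smul_sum]

/-- For a coordinate `ξ i`, the map `y ↦ y i • m` is Γ-equivariant, so composing it with `toRegular`
gives trace `ξ i • m` at `x`. Right translates are absorbed into `m`, and sums and multiples are
additive in `θ`. -/
theorem exists_relTrace_eq_action [Fintype (Γ ⧸ H)] (he : IsFreeBasis ρ e) (x : M)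
    {a : Γ →₀ k} (ha : a ∈ coordIdeal (relTrace H ρ (leftTranslation k Γ B) (toRegular e) x)) :
    ∀ m, ∃ θ, IsEquivariantOn H ρ ρ θ ∧ relTrace H ρ ρ θ x = groupAlgebraAction ρ a m := by
  induction ha using Submodule.span_induction with
  | mem a ha =>
    obtain ⟨⟨γ, i⟩, rfl⟩ := ha
    intro m
    have h1 := coordAction_isEquivariant (k := k) (ρ := ρ) i (ρ γ⁻¹ m)
    refine ⟨coordAction ρ i (ρ γ⁻¹ m) ∘ₗ toRegular e,
      (h1.mono le_top).comp (toRegular_isEquivariantOn he), ?_⟩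
    rw [comp_relTrace h1]
    simp only [groupAlgebraAction_rightTranslation]
    rfl
  | zero => exact fun m => ⟨0, fun _ _ _ => by simp, by simp [relTrace_apply]⟩
  | add a b _ _ iha ihb =>
    intro m
    obtain ⟨θ₁, h₁, e₁⟩ := iha m
    obtain ⟨θ₂, h₂, e₂⟩ := ihb m
    exact ⟨θ₁ + θ₂, h₁.add h₂, by simp [relTrace_add, e₁, e₂]⟩
  | smul c a _ ih =>
    intro m
    obtain ⟨θ, h, e₁⟩ := ih m
    exact ⟨c • θ, fun g hg y => by simp [h g hg], by simp [relTrace_smul, e₁]⟩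

/-- The right ideal generated by the coordinates of `ξ`, as a representation. -/
theorem exists_coordIdeal_representation (ξ : B →₀ Γ →₀ k) :
    ∃ (A : Type (max w v)) (_ : AddCommGroup A) (_ : Module k A) (α : Representation k Γ A)
      (j : A →ₗ[k] Γ →₀ k), Function.Injective j ∧
      (∀ γ a, j (α γ a) = rightTranslation k Γ γ (j a)) ∧ LinearMap.range j = coordIdeal ξ :=
  ⟨coordIdeal ξ, inferInstance, inferInstance,
    (rightTranslation k Γ).subrepresentation (coordIdeal ξ) (coordIdeal_le_comap ξ),
    (coordIdeal ξ).subtype, Subtype.val_injective, fun _ _ => rfl, Submodule.range_subtype _⟩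

theorem locallyTrace_of_coinvariantsAreNorms [H.Normal] [Fintype (Γ ⧸ H)] (he : IsFreeBasis ρ e)
    (hnorm : ∀ (A : Type (max w v)) [AddCommGroup A] [Module k A] (α : Representation k Γ A)
      (j : A →ₗ[k] Γ →₀ k), Function.Injective j → CoinvariantsAreNorms H (α.tprod ρ)) :
    LocallyTrace H ρ := by
  intro x
  set ξ := relTrace H ρ (leftTranslation k Γ B) (toRegular e) x with hξ
  obtain ⟨A, _, _, α, j, hj, hα, hrange⟩ := exists_coordIdeal_representation ξ
  have hmem : ∀ a, j a ∈ coordIdeal ξ := fun a => hrange ▸ LinearMap.mem_range_self j a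
  have hcoord : ∀ i, ∃ a, j a = ξ i := fun i =>
    LinearMap.mem_range.1 (hrange ▸ coord_mem_coordIdeal ξ i)
  choose a ha using hcoord
  obtain ⟨D, hD, hker⟩ := exists_tprod_toFinsupp he hj hα
  let w : A ⊗[k] M := ∑ i ∈ ξ.support, a i ⊗ₜ e (1, i)
  -- `lsum_smulToRegular_relTrace` is exactly the invariance of the class of `w`.
  have hDγ : ∀ γ, D ((α.tprod ρ) γ w) = ξ := by
    intro γ
    refine Eq.trans ?_ (lsum_smulToRegular_relTrace he γ x)
    rw [← hξ, Finsupp.lsum_apply, Finsupp.sum]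
    simp [w, hD, hα, ha]
  have hDw : D w = ξ := by simpa using hDγ 1
  obtain ⟨v, hv⟩ := hnorm A α j hj w fun γ => (hker _).2 (by rw [map_sub, hDγ, hDw, sub_self])
  have hDv : ∀ v, D (∑ g : Γ ⧸ H, (α.tprod ρ) g.out v) =
      relTrace H ρ (leftTranslation k Γ B) (toRegular e)
        (TensorProduct.lift (groupAlgebraAction ρ ∘ₗ j) v) := by
    intro v
    induction v using TensorProduct.induction_on with
    | zero => simp
    | tmul a m => simp [hD, hα, ← sum_smulToRegular he]
    | add a b iha ihb => simp only [map_add, Finset.sum_add_distrib, iha, ihb]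
  have hxv : TensorProduct.lift (groupAlgebraAction ρ ∘ₗ j) v = x := by
    refine relTrace_toRegular_injective he ?_
    have h := (hker _).1 hv
    rw [map_sub, hDw, sub_eq_zero] at h
    rw [← hDv, ← h]
  have hex : ∀ v, ∃ θ, IsEquivariantOn H ρ ρ θ ∧ relTrace H ρ ρ θ x =
      TensorProduct.lift (groupAlgebraAction ρ ∘ₗ j) v := by
    intro v
    induction v using TensorProduct.induction_on with
    | zero => exact ⟨0, fun _ _ _ => by simp, by simp [relTrace_apply]⟩
    | tmul a m => simpa using exists_relTrace_eq_action he x (hmem a) m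
    | add a b iha ihb =>
      obtain ⟨θ₁, h₁, e₁⟩ := iha
      obtain ⟨θ₂, h₂, e₂⟩ := ihb
      exact ⟨θ₁ + θ₂, h₁.add h₂, by simp [relTrace_add, e₁, e₂]⟩
  obtain ⟨θ, hθ, h⟩ := hex v
  exact ⟨θ, hθ, h.trans hxv⟩

end LocalTrace

/-! ### Relative traces on retracts of free modules. -/

section FreeModules

variable {k Γ M B : Type*} [CommRing k] [Group Γ] [AddCommMonoid M] [Module k M]
  {ρ : Representation k Γ M} {b : B → M} {H : Subgroup Γ}

/-- The map from the free module sending the basis to the family `b`. -/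
noncomputable def fromFree (ρ : Representation k Γ M) (b : B → M) : (B →₀ Γ →₀ k) →ₗ[k] M :=
  Finsupp.lsum k fun i => Finsupp.linearCombination k fun γ => ρ γ (b i)

theorem fromFree_isEquivariant :
    IsEquivariantOn ⊤ (leftTranslation k Γ B) ρ (fromFree ρ b) := by
  intro γ _ y
  have : fromFree ρ b ∘ₗ leftTranslation k Γ B γ = ρ γ ∘ₗ fromFree ρ b := by
    ext i δ
    simp [leftTranslation_single_single, fromFree]
  exact LinearMap.congr_fun this y

theorem fromFree_toRegular {e : Module.Basis (H × B) k M} (he : IsFreeBasis ρ e) (x : M) :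
    fromFree ρ (fun i => e (1, i)) (toRegular e x) = x := by
  have : fromFree ρ (fun i => e (1, i)) ∘ₗ toRegular e = LinearMap.id := by
    refine e.ext fun p => ?_
    obtain ⟨h, i⟩ := p
    rw [LinearMap.comp_apply, toRegular_basis]
    simp [fromFree, he.eq h i]
  exact LinearMap.congr_fun this x

theorem fromFreeOn_isEquivariantOn :
    IsEquivariantOn H (leftTranslation k Γ B) ρ (fromFreeOn H ρ b) := by
  classical
  intro h hh y
  have : fromFreeOn H ρ b ∘ₗ leftTranslation k Γ B h = ρ h ∘ₗ fromFreeOn H ρ b := by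
    ext i δ
    have hiff : h * δ ∈ H ↔ δ ∈ H := H.mul_mem_cancel_left hh
    simp only [LinearMap.comp_apply, Finsupp.lsingle_apply]
    rw [leftTranslation_single_single]
    by_cases hδ : δ ∈ H <;> simp [fromFreeOn, hiff, hδ]
  exact LinearMap.congr_fun this y

/-- Each `δ` lies in exactly one coset, so exactly one summand of the trace sees it. -/
theorem relTrace_fromFreeOn [Fintype (Γ ⧸ H)] :
    relTrace H (leftTranslation k Γ B) ρ (fromFreeOn H ρ b) = fromFree ρ b := by
  classical
  ext i δ
  simp only [LinearMap.comp_apply, Finsupp.lsingle_apply]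
  rw [relTrace_apply, Finset.sum_eq_single (δ : Γ ⧸ H)]
  · have h : ((δ : Γ ⧸ H).out)⁻¹ * δ ∈ H := QuotientGroup.eq.1 (QuotientGroup.out_eq' _)
    rw [leftTranslation_single_single]
    simp [fromFreeOn, fromFree, h]
  · intro g _ hg
    have h : g.out⁻¹ * δ ∉ H := fun h =>
      hg ((QuotientGroup.out_eq' g).symm.trans (QuotientGroup.eq.2 h))
    rw [leftTranslation_single_single]
    simp [fromFreeOn, h]
  · simp

/-- A retract of a free module has an `H`-equivariant endomorphism of relative trace `1`. -/
theorem exists_relTrace_eq_id_of_section [Fintype (Γ ⧸ H)] {s : M →ₗ[k] B →₀ Γ →₀ k}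
    (hs : IsEquivariantOn ⊤ ρ (leftTranslation k Γ B) s) (h : ∀ m, fromFree ρ b (s m) = m) :
    ∃ θ, IsEquivariantOn H ρ ρ θ ∧ relTrace H ρ ρ θ = LinearMap.id :=
  ⟨fromFreeOn H ρ b ∘ₗ s, fromFreeOn_isEquivariantOn.comp (hs.mono le_top), by
    rw [relTrace_comp hs, relTrace_fromFreeOn]
    exact LinearMap.ext h⟩

end FreeModules

/-! ### Higman's criterion for modules over ℤΓ. -/

section GroupRingModules

/-- An additive map commuting with the elements of `Γ` is linear over the group ring. -/
theorem map_groupRing_smul {Γ M N : Type*} [Group Γ] [AddCommGroup M]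
    [Module (MonoidAlgebra ℤ Γ) M] [AddCommGroup N] [Module (MonoidAlgebra ℤ Γ) N]
    (f : M →+ N) (hf : ∀ (γ : Γ) (m : M), f (MonoidAlgebra.single γ (1 : ℤ) • m) =
      MonoidAlgebra.single γ (1 : ℤ) • f m) (a : MonoidAlgebra ℤ Γ) (m : M) :
    f (a • m) = a • f m := by
  induction a using MonoidAlgebra.induction_linear with
  | zero => simp
  | add a b iha ihb => simp [add_smul, iha, ihb]
  | single γ n =>
    have : (MonoidAlgebra.single γ n : MonoidAlgebra ℤ Γ) =
        n • MonoidAlgebra.single γ (1 : ℤ) := by simp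
    rw [this, smul_assoc, smul_assoc, map_zsmul, hf]

variable {Γ : Type*} [Group Γ] {M : Type*} [AddCommGroup M] {_ : Module ℤ M}
  [Module (MonoidAlgebra ℤ Γ) M] {ρ : Representation ℤ Γ M}

/-- The additive isomorphism from the free `kΓ`-module to its underlying functions. -/
noncomputable def freeCoeff (Γ B : Type*) : (B →₀ MonoidAlgebra ℤ Γ) ≃+ (B →₀ Γ →₀ ℤ) :=
  Finsupp.mapRange.addEquiv (MonoidAlgebra.coeffAddEquiv)

theorem freeCoeff_symm_single {B : Type*} (i : B) (γ : Γ) (n : ℤ) :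
    (freeCoeff Γ B).symm (Finsupp.single i (Finsupp.single γ n)) =
      Finsupp.single i (MonoidAlgebra.single γ n) := by
  simp [freeCoeff]

theorem freeCoeff_symm_leftTranslation {B : Type*} (γ : Γ) (y : B →₀ Γ →₀ ℤ) :
    (freeCoeff Γ B).symm (leftTranslation ℤ Γ B γ y) =
      MonoidAlgebra.single γ (1 : ℤ) • (freeCoeff Γ B).symm y := by
  have : (freeCoeff Γ B).symm.toAddMonoidHom.comp (leftTranslation ℤ Γ B γ).toAddMonoidHom =
      (DistribSMul.toAddMonoidHom _ (MonoidAlgebra.single γ (1 : ℤ))).comp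
        (freeCoeff Γ B).symm.toAddMonoidHom := by
    ext i δ : 3
    ext
    simp [leftTranslation_single_single, freeCoeff_symm_single]
  exact DFunLike.congr_fun this y

theorem linearCombination_freeCoeff_symm
    (hρ : ∀ γ m, ρ γ m = MonoidAlgebra.single γ (1 : ℤ) • m) {B : Type*} (b : B → M)
    (y : B →₀ Γ →₀ ℤ) :
    Finsupp.linearCombination (MonoidAlgebra ℤ Γ) b ((freeCoeff Γ B).symm y) =
      fromFree ρ b y := by
  have key : (Finsupp.linearCombination (MonoidAlgebra ℤ Γ) b).toAddMonoidHom.comp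
      (freeCoeff Γ B).symm.toAddMonoidHom = (fromFree ρ b).toAddMonoidHom := by
    refine Finsupp.addHom_ext' fun i => Finsupp.addHom_ext' fun γ => AddMonoidHom.ext_int ?_
    simp [freeCoeff_symm_single, fromFree, hρ]
    exact ((int_smul_eq_zsmul _ 1 _).trans (one_zsmul _)).symm
  exact DFunLike.congr_fun key y

theorem projective_of_section (hρ : ∀ γ m, ρ γ m = MonoidAlgebra.single γ (1 : ℤ) • m)
    {B : Type*} (b : B → M) (s : M →ₗ[ℤ] B →₀ Γ →₀ ℤ)
    (hs : ∀ γ m, s (ρ γ m) = leftTranslation ℤ Γ B γ (s m)) (h : ∀ m, fromFree ρ b (s m) = m) :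
    Module.Projective (MonoidAlgebra ℤ Γ) M := by
  let S : M →ₗ[MonoidAlgebra ℤ Γ] (B →₀ MonoidAlgebra ℤ Γ) :=
    { toFun := fun m => (freeCoeff Γ B).symm (s m)
      map_add' := by simp
      map_smul' := map_groupRing_smul ((freeCoeff Γ B).symm.toAddMonoidHom.comp s.toAddMonoidHom)
        fun γ m => by
          simp [← hρ, hs, freeCoeff_symm_leftTranslation] }
  refine Module.Projective.of_split S (Finsupp.linearCombination _ b) (LinearMap.ext fun m => ?_)
  exact (linearCombination_freeCoeff_symm hρ b (s m)).trans (h m)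

theorem exists_section_of_projective (hρ : ∀ γ m, ρ γ m = MonoidAlgebra.single γ (1 : ℤ) • m)
    [Module.Projective (MonoidAlgebra ℤ Γ) M] :
    ∃ s : M →ₗ[ℤ] M →₀ Γ →₀ ℤ, IsEquivariantOn ⊤ ρ (leftTranslation ℤ Γ M) s ∧
      ∀ m, fromFree ρ id (s m) = m := by
  obtain ⟨S, hS⟩ := Module.projective_def'.1 ‹Module.Projective (MonoidAlgebra ℤ Γ) M›
  let s : M →+ M →₀ Γ →₀ ℤ := (freeCoeff Γ M).toAddMonoidHom.comp S.toAddMonoidHom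
  refine ⟨⟨⟨s, s.map_add⟩, fun n m => ?_⟩, fun γ _ m => ?_, fun m => ?_⟩
  · exact (congrArg s (int_smul_eq_zsmul _ n m)).trans (map_zsmul s n m)
  · apply (freeCoeff Γ M).symm.injective
    rw [freeCoeff_symm_leftTranslation]
    simp [s, hρ]
  · change fromFree ρ id (freeCoeff Γ M (S m)) = m
    rw [← linearCombination_freeCoeff_symm hρ, AddEquiv.symm_apply_apply]
    exact LinearMap.congr_fun hS m

/-- The H-equivariant splitting `toRegular e` of `fromFree`, composed with `θ` and averaged by the
trace, becomes a Γ-equivariant splitting. -/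
theorem projective_of_relTrace_eq_id {H : Subgroup Γ} [Fintype (Γ ⧸ H)] {B : Type*}
    (hρ : ∀ γ m, ρ γ m = MonoidAlgebra.single γ (1 : ℤ) • m) {e : Module.Basis (H × B) ℤ M}
    (he : IsFreeBasis ρ e) {θ : M →ₗ[ℤ] M} (hθ : IsEquivariantOn H ρ ρ θ)
    (htr : relTrace H ρ ρ θ = LinearMap.id) : Module.Projective (MonoidAlgebra ℤ Γ) M := by
  have h1 : IsEquivariantOn H ρ (leftTranslation ℤ Γ B) (toRegular e ∘ₗ θ) :=
    (toRegular_isEquivariantOn he).comp hθ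
  refine projective_of_section hρ (fun i => e (1, i))
    (relTrace H ρ (leftTranslation ℤ Γ B) (toRegular e ∘ₗ θ))
    (fun γ m => relTrace_isEquivariant h1 γ trivial m) fun m => ?_
  have h2 : fromFree ρ (fun i => e (1, i)) ∘ₗ toRegular e ∘ₗ θ = θ :=
    LinearMap.ext fun x => fromFree_toRegular he _
  have h3 := comp_relTrace (H := H) (ρ := ρ) (θ := toRegular e ∘ₗ θ)
    (fromFree_isEquivariant (ρ := ρ) (b := fun i => e (1, i)))
  rw [h2, htr] at h3
  exact (LinearMap.congr_fun h3 m).symm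

end GroupRingModules

/-! ### Induction along `φ` and comparison of coinvariants. -/

section Induction

open Representation

variable {k : Type*} {Γ : Type u} {Γ' : Type v} {W : Type w} [CommRing k] [Group Γ] [Group Γ'] [AddCommGroup W] [Module k W]

/-- The action of `Γ` on `kΓ' ⊗ W` given by `γ • (γ' ⊗ w) = γ' φ(γ)⁻¹ ⊗ γ w`. -/
noncomputable def inductionRep (φ : Γ →* Γ') (ρ : Representation k Γ W) :
    Representation k Γ (Γ' →₀ W) where
  toFun γ := Finsupp.lsum k fun γ' => Finsupp.lsingle (γ' * (φ γ)⁻¹) ∘ₗ ρ γ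
  map_one' := by ext; simp
  map_mul' a b := by ext; simp [mul_assoc]

/-- The module `kΓ' ⊗_{kΓ} W` induced along `φ : Γ → Γ'`. -/
abbrev InducedModule (φ : Γ →* Γ') (ρ : Representation k Γ W) : Type _ :=
  Coinvariants (inductionRep φ ρ)

variable {φ : Γ →* Γ'} {ρ : Representation k Γ W}

/-- The element `γ' ⊗ w` of the induced module. -/
noncomputable def inducedMk (φ : Γ →* Γ') (ρ : Representation k Γ W) (γ' : Γ') :
    W →ₗ[k] InducedModule φ ρ :=
  Coinvariants.mk _ ∘ₗ Finsupp.lsingle γ'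

theorem inductionRep_single (γ : Γ) (γ' : Γ') (w : W) :
    inductionRep φ ρ γ (Finsupp.single γ' w) = Finsupp.single (γ' * (φ γ)⁻¹) (ρ γ w) := by
  simp [inductionRep]

theorem inducedMk_mul (γ : Γ) (γ' : Γ') (w : W) :
    inducedMk φ ρ (γ' * φ γ) w = inducedMk φ ρ γ' (ρ γ w) := by
  have := Coinvariants.mk_self_apply (inductionRep φ ρ) γ (Finsupp.single (γ' * φ γ) w)
  rw [inductionRep_single, mul_inv_cancel_right] at this
  exact this.symm

/-- Maps out of the induced module. -/
noncomputable def inducedLift {X : Type*} [AddCommGroup X] [Module k X] (F : Γ' → W →ₗ[k] X)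
    (hF : ∀ γ γ' w, F (γ' * (φ γ)⁻¹) (ρ γ w) = F γ' w) : InducedModule φ ρ →ₗ[k] X :=
  Coinvariants.lift _ (Finsupp.lsum k F) fun γ => by
    ext γ' w
    simp [inductionRep_single, hF]

theorem inducedLift_mk {X : Type*} [AddCommGroup X] [Module k X] (F : Γ' → W →ₗ[k] X)
    (hF : ∀ γ γ' w, F (γ' * (φ γ)⁻¹) (ρ γ w) = F γ' w) (γ' : Γ') (w : W) :
    inducedLift F hF (inducedMk φ ρ γ' w) = F γ' w := by
  simp [inducedLift, inducedMk]

theorem exists_inducedLift {X : Type*} [AddCommMonoid X] [Module k X] (F : Γ' → W →ₗ[k] X)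
    (hF : ∀ γ γ' w, F (γ' * (φ γ)⁻¹) (ρ γ w) = F γ' w) :
    ∃ L : InducedModule φ ρ →ₗ[k] X, ∀ γ' w, L (inducedMk φ ρ γ' w) = F γ' w := by
  let _ : AddCommGroup X := Module.addCommMonoidToAddCommGroup k
  exact ⟨inducedLift F hF, inducedLift_mk F hF⟩

theorem induced_hom_ext {X : Type*} [AddCommMonoid X] [Module k X]
    {f g : InducedModule φ ρ →ₗ[k] X}
    (h : ∀ γ' w, f (inducedMk φ ρ γ' w) = g (inducedMk φ ρ γ' w)) : f = g := by
  have key : f ∘ₗ Coinvariants.mk _ = g ∘ₗ Coinvariants.mk _ :=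
    Finsupp.lhom_ext fun γ' w => h γ' w
  exact LinearMap.ext fun x => Coinvariants.induction_on x fun v => LinearMap.congr_fun key v

/-- The action of `Γ'` on the induced module by left multiplication. -/
noncomputable def inducedRep (φ : Γ →* Γ') (ρ : Representation k Γ W) :
    Representation k Γ' (InducedModule φ ρ) where
  toFun δ := inducedLift (fun γ' => inducedMk φ ρ (δ * γ')) fun γ γ' w => by
    rw [← inducedMk_mul, mul_assoc, inv_mul_cancel_right]
  map_one' := induced_hom_ext fun γ' w => by simp [inducedLift_mk]
  map_mul' a b := induced_hom_ext fun γ' w => by simp [inducedLift_mk, mul_assoc]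

theorem inducedRep_mk (δ γ' : Γ') (w : W) :
    inducedRep φ ρ δ (inducedMk φ ρ γ' w) = inducedMk φ ρ (δ * γ') w := by
  simp [inducedRep, inducedLift_mk]

variable {H : Subgroup Γ} {H' : Subgroup Γ'} [H.Normal] {ψ : Γ' →* Γ ⧸ H} {B : Type*}
  {e : Module.Basis (H × B) k W}

theorem mul_inv_mem_of_map_eq (hker : ψ.ker = H') (hψφ : ∀ γ, ψ (φ γ) = γ) {γ' : Γ'} {t : Γ}
    (ht : (t : Γ ⧸ H) = ψ γ') : γ' * (φ t)⁻¹ ∈ H' := by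
  rw [← hker, MonoidHom.mem_ker, map_mul, map_inv, hψφ, ht, mul_inv_cancel]

theorem map_mem_of_mem (hker : ψ.ker = H') (hψφ : ∀ γ, ψ (φ γ) = γ) {h : Γ} (hh : h ∈ H) :
    φ h ∈ H' := by
  rw [← hker, MonoidHom.mem_ker, hψφ]
  exact (QuotientGroup.eq_one_iff h).2 hh

/-- If `W` is free over `kH`, the module induced along `φ` is free over `kH'`, expressed by a
section of the map from the free module on the same basis. -/
theorem exists_induced_section (he : IsFreeBasis ρ e) (hker : ψ.ker = H')
    (hψφ : ∀ γ, ψ (φ γ) = γ) :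
    ∃ s : InducedModule φ ρ →ₗ[k] (B →₀ H' →₀ k),
      (∀ (h : H') n, s (inducedRep φ ρ h n) = leftTranslation k H' B h (s n)) ∧
      ∀ n, fromFree ((inducedRep φ ρ).comp H'.subtype) (fun i => inducedMk φ ρ 1 (e (1, i)))
        (s n) = n := by
  let φH : H →* H' := (φ.comp H.subtype).codRestrict H' fun h => map_mem_of_mem hker hψφ h.2
  let β : W →ₗ[k] (B →₀ H' →₀ k) :=
    e.constr k fun p => Finsupp.single p.2 (Finsupp.single (φH p.1) 1)
  have hβe : ∀ h i, β (e (h, i)) = Finsupp.single i (Finsupp.single (φH h) 1) := by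
    intro h i
    simp [β]
  have hβ : ∀ h w, β (ρ (h : H) w) = leftTranslation k H' B (φH h) (β w) := by
    intro h w
    have : β ∘ₗ ρ (h : H) = leftTranslation k H' B (φH h) ∘ₗ β := by
      refine e.ext fun p => ?_
      obtain ⟨h', i⟩ := p
      simp only [LinearMap.comp_apply]
      rw [he, hβe, hβe, leftTranslation_single_single, map_mul]
    exact LinearMap.congr_fun this w
  -- For `t` lifting `ψ γ'` one has `γ' ⊗ w = γ' φ(t)⁻¹ ⊗ t w`, whose first factor lies in `H'`.
  -- `hFt` shows that the choice of `t` does not matter.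
  obtain ⟨F, hFdef⟩ : ∃ F : Γ' → W →ₗ[k] (B →₀ H' →₀ k), ∀ γ' w, F γ' w =
      leftTranslation k H' B ⟨γ' * (φ (ψ γ').out)⁻¹,
        mul_inv_mem_of_map_eq hker hψφ (QuotientGroup.out_eq' _)⟩ (β (ρ (ψ γ').out w)) :=
    ⟨fun γ' => leftTranslation k H' B _ ∘ₗ β ∘ₗ ρ (ψ γ').out, fun _ _ => rfl⟩
  have hFt : ∀ γ' (t : Γ) (ht : (t : Γ ⧸ H) = ψ γ') w, F γ' w = leftTranslation k H' B
      ⟨γ' * (φ t)⁻¹, mul_inv_mem_of_map_eq hker hψφ ht⟩ (β (ρ t w)) := by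
    intro γ' t ht w
    have hmem : t * ((ψ γ').out)⁻¹ ∈ H := by
      rw [← QuotientGroup.eq_one_iff, QuotientGroup.mk_mul, QuotientGroup.mk_inv,
        QuotientGroup.out_eq', ht, mul_inv_cancel]
    have h1 : ρ t w = ρ ((⟨_, hmem⟩ : H) : Γ) (ρ (ψ γ').out w) := by
      rw [← Module.End.mul_apply, ← map_mul]; simp
    rw [h1, hβ, ← Module.End.mul_apply, ← map_mul]
    rw [hFdef]
    congr 2
    ext
    simp [φH, mul_assoc]
  have hF : ∀ γ γ' w, F (γ' * (φ γ)⁻¹) (ρ γ w) = F γ' w := by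
    intro γ γ' w
    have h1 : (((ψ γ').out * γ⁻¹ : Γ) : Γ ⧸ H) = ψ (γ' * (φ γ)⁻¹) := by
      rw [QuotientGroup.mk_mul, QuotientGroup.out_eq', map_mul, map_inv, hψφ,
        QuotientGroup.mk_inv]
    rw [hFt _ _ h1, hFt γ' _ (QuotientGroup.out_eq' _), ← Module.End.mul_apply, ← map_mul]
    congr 2
    · congr 1
      simp
    · simp
  obtain ⟨L, hL⟩ : ∃ L : InducedModule φ ρ →ₗ[k] (B →₀ H' →₀ k),
      ∀ γ' w, L (inducedMk φ ρ γ' w) = F γ' w := exists_inducedLift F hF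
  refine ⟨L, fun h n => ?_, fun n => ?_⟩
  · have : L ∘ₗ inducedRep φ ρ h =
        leftTranslation k H' B h ∘ₗ L := by
      refine induced_hom_ext fun γ' w => ?_
      simp only [LinearMap.comp_apply]
      rw [inducedRep_mk, hL, hL]
      have h1 : (((ψ γ').out : Γ) : Γ ⧸ H) = ψ (h * γ') := by
        have : (h : Γ') ∈ ψ.ker := hker ▸ h.2
        rw [QuotientGroup.out_eq', map_mul, MonoidHom.mem_ker.1 this, one_mul]
      rw [hFt _ _ h1, hFt γ' _ (QuotientGroup.out_eq' _), ← Module.End.mul_apply, ← map_mul]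
      congr 2
      ext
      simp [mul_assoc]
    exact LinearMap.congr_fun this n
  · set r := fromFree ((inducedRep φ ρ).comp H'.subtype) (fun i => inducedMk φ ρ 1 (e (1, i)))
      with hr
    have hrβ : ∀ (h' : H') w, r (leftTranslation k H' B h' (β w)) = inducedMk φ ρ h' w := by
      intro h' w
      have : r ∘ₗ leftTranslation k H' B h' ∘ₗ β = inducedMk φ ρ h' := by
        refine e.ext fun p => ?_
        obtain ⟨h, i⟩ := p
        simp only [LinearMap.comp_apply]
        rw [hβe, leftTranslation_single_single, he.eq h i, ← inducedMk_mul]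
        simp [hr, fromFree, inducedRep_mk, φH]
      exact LinearMap.congr_fun this w
    have : r ∘ₗ L = LinearMap.id := by
      refine induced_hom_ext fun γ' w => ?_
      rw [LinearMap.comp_apply, hL]
      rw [hFdef, hrβ, ← inducedMk_mul, LinearMap.id_apply]
      simp
    exact LinearMap.congr_fun this n

/-- `Θ` sends `γ' ⊗ w` to `ψ(γ')[w]` in W_H. For an invariant class `[w]` and `n = 1 ⊗ w`, `Θ ∘ θ`
is constant on the Γ'-orbit of `n`. Applying `Θ` to `n = ∑ g θ(g⁻¹ n)` therefore exhibits `[w]` as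
the norm of `Θ (θ n)`. -/
theorem coinvariantsAreNorms_of_relTrace_eq_id [Fintype (Γ ⧸ H)] [Fintype (Γ' ⧸ H')]
    (hker : ψ.ker = H') (hψφ : ∀ γ, ψ (φ γ) = γ)
    {θ : InducedModule φ ρ →ₗ[k] InducedModule φ ρ}
    (hθ : IsEquivariantOn H' (inducedRep φ ρ) (inducedRep φ ρ) θ)
    (htr : relTrace H' (inducedRep φ ρ) (inducedRep φ ρ) θ = LinearMap.id) :
    CoinvariantsAreNorms H ρ := by
  intro w hw
  set C := quotientToCoinvariants ρ H with hC
  let Θ : InducedModule φ ρ →ₗ[k] Coinvariants (ρ.comp H.subtype) :=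
    inducedLift (fun γ' => C (ψ γ') ∘ₗ Coinvariants.mk _) fun γ γ' w => by
      have : Coinvariants.mk (ρ.comp H.subtype) (ρ γ w) =
          C (γ : Γ ⧸ H) (Coinvariants.mk (ρ.comp H.subtype) w) := rfl
      simp only [LinearMap.comp_apply]
      rw [this, ← Module.End.mul_apply, ← map_mul C, map_mul ψ, map_inv ψ, hψφ,
        inv_mul_cancel_right]
  have hΘ : ∀ γ' w, Θ (inducedMk φ ρ γ' w) = C (ψ γ') (Coinvariants.mk _ w) :=
    fun γ' w => inducedLift_mk (X := Coinvariants (ρ.comp H.subtype)) _ _ γ' w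
  have hΘσ : ∀ δ n, Θ (inducedRep φ ρ δ n) = C (ψ δ) (Θ n) := by
    intro δ n
    have : Θ ∘ₗ inducedRep φ ρ δ = C (ψ δ) ∘ₗ Θ := by
      refine induced_hom_ext fun γ' w => ?_
      simp only [LinearMap.comp_apply]
      rw [inducedRep_mk, hΘ, hΘ, map_mul, map_mul, Module.End.mul_apply]
    exact LinearMap.congr_fun this n
  have hΩ : ∀ h' ∈ H', ∀ n, Θ (θ (inducedRep φ ρ h' n)) = Θ (θ n) := by
    intro h' hh' n
    have h1 : h' ∈ ψ.ker := hker ▸ hh'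
    rw [hθ h' hh', hΘσ, MonoidHom.mem_ker.1 h1, map_one C, Module.End.one_apply]
  have hle : Coinvariants.ker (ρ.comp H.subtype) ≤
      LinearMap.ker (Θ ∘ₗ θ ∘ₗ inducedMk φ ρ 1) := by
    rw [Coinvariants.ker, Submodule.span_le]
    rintro _ ⟨⟨h, x⟩, rfl⟩
    have h1 : inducedMk φ ρ 1 (ρ h x) = inducedRep φ ρ (φ h) (inducedMk φ ρ 1 x) := by
      rw [← inducedMk_mul, inducedRep_mk, one_mul, mul_one]
    simp [h1, hΩ _ (map_mem_of_mem hker hψφ h.2)]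
  set n := inducedMk φ ρ 1 w with hn
  have hinv : ∀ γ', Θ (θ (inducedRep φ ρ γ' n)) = Θ (θ n) := by
    intro γ'
    have hmem := mul_inv_mem_of_map_eq hker hψφ (QuotientGroup.out_eq' (ψ γ'))
    set t := (ψ γ').out
    -- Modulo `H'`, moving `n` by `γ'` amounts to moving `w` by `t`, which leaves its class
    -- unchanged.
    have h1 : inducedRep φ ρ γ' n =
        inducedRep φ ρ (γ' * (φ t)⁻¹) (inducedMk φ ρ 1 (ρ t w)) := by
      rw [hn, ← inducedMk_mul, inducedRep_mk, inducedRep_mk]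
      simp
    rw [h1, hΩ _ hmem, ← sub_eq_zero]
    have := hle (hw t)
    rwa [LinearMap.mem_ker, map_sub] at this
  obtain ⟨v, hv⟩ := Coinvariants.mk_surjective (ρ.comp H.subtype) (Θ (θ n))
  refine ⟨v, (Coinvariants.mk_eq_iff _).1 ?_⟩
  have hψs : Function.Surjective ψ := fun g => by
    obtain ⟨γ, rfl⟩ := QuotientGroup.mk_surjective g
    exact ⟨φ γ, hψφ γ⟩
  let E : (Γ' ⧸ H') ≃ (Γ ⧸ H) :=
    (Subgroup.quotientEquivOfEq hker.symm).trans (QuotientGroup.quotientKerEquivOfSurjective ψ hψs).toEquiv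
  have hE : ∀ g : Γ', E (g : Γ' ⧸ H') = ψ g := fun g => rfl
  calc Coinvariants.mk (ρ.comp H.subtype) w = Θ n := by rw [hn, hΘ]; simp
    _ = Θ (relTrace H' (inducedRep φ ρ) (inducedRep φ ρ) θ n) := by rw [htr]; rfl
    _ = ∑ g : Γ' ⧸ H', C (ψ g.out) (Coinvariants.mk _ v) := by
      rw [relTrace_apply, map_sum]
      exact Finset.sum_congr rfl fun g _ => by rw [hΘσ, hinv, hv]
    _ = ∑ g : Γ ⧸ H, C g (Coinvariants.mk _ v) :=
      Fintype.sum_equiv E _ _ fun g => by rw [← hE, QuotientGroup.out_eq']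
    _ = Coinvariants.mk _ (∑ g : Γ ⧸ H, ρ g.out v) := by
      rw [map_sum]
      refine Finset.sum_congr rfl fun g _ => ?_
      conv_lhs => rw [← QuotientGroup.out_eq' g]
      rfl

/-- The properties of the induced module that do not refer to its construction. -/
theorem exists_induced [Fintype (Γ ⧸ H)] [Fintype (Γ' ⧸ H')] (he : IsFreeBasis ρ e)
    (hker : ψ.ker = H') (hψφ : ∀ γ, ψ (φ γ) = γ) :
    ∃ (N : Type (max v w)) (_ : AddCommGroup N) (_ : Module k N) (σ : Representation k Γ' N) (b : B → N)
      (s : N →ₗ[k] (B →₀ H' →₀ k)),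
      (∀ (h : H') n, s (σ h n) = leftTranslation k H' B h (s n)) ∧
      (∀ n, fromFree (σ.comp H'.subtype) b (s n) = n) ∧
      ((∃ θ, IsEquivariantOn H' σ σ θ ∧ relTrace H' σ σ θ = LinearMap.id) →
        CoinvariantsAreNorms H ρ) := by
  obtain ⟨s, hs, hb⟩ := exists_induced_section he hker hψφ
  exact ⟨InducedModule φ ρ, inferInstance, inferInstance, inducedRep φ ρ, _, s, hs, hb,
    fun ⟨_, hθ, htr⟩ => coinvariantsAreNorms_of_relTrace_eq_id hker hψφ hθ htr⟩

end Induction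

/-! ### The Eilenberg swindle. -/

section Swindle

/-- The Eilenberg swindle: if `M` is a retract of `F`, then `M × F^(ℕ) ≃ F^(ℕ)`. -/
theorem exists_swindle {k M F : Type*} [CommRing k] [AddCommGroup M] [AddCommGroup F] [Module k M]
    [Module k F] (s : M →ₗ[k] F) (p : F →ₗ[k] M) (hps : ∀ m, p (s m) = m) :
    ∃ α : (M × (ℕ →₀ F)) ≃ₗ[k] (ℕ →₀ F), ∀ m f,
      α (m, f) 0 = f 0 - s (p (f 0)) + s m ∧
      ∀ n, α (m, f) (n + 1) = f (n + 1) - s (p (f (n + 1))) + s (p (f n)) := by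
  -- `F` splits as ker p ⊕ s(M). `A` keeps the ker p parts in place and shifts the s(M) parts up by
  -- one, freeing slot `0` for `m`; `C` shifts back.
  let q : F →ₗ[k] F := LinearMap.id - s ∘ₗ p
  let A : (M × (ℕ →₀ F)) →ₗ[k] (ℕ →₀ F) := LinearMap.coprod (Finsupp.lsingle 0 ∘ₗ s)
    (Finsupp.mapRange.linearMap q +
      Finsupp.lmapDomain F k Nat.succ ∘ₗ Finsupp.mapRange.linearMap (s ∘ₗ p))
  let C : (ℕ →₀ F) →ₗ[k] (M × (ℕ →₀ F)) := LinearMap.prod (p ∘ₗ Finsupp.lapply 0)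
    (Finsupp.mapRange.linearMap q +
      Finsupp.lcomapDomain Nat.succ Nat.succ_injective ∘ₗ Finsupp.mapRange.linearMap (s ∘ₗ p))
  have hA0 : ∀ m f, A (m, f) 0 = f 0 - s (p (f 0)) + s m := by
    intro m f
    have : (Finsupp.mapDomain Nat.succ (Finsupp.mapRange (s ∘ₗ p) (map_zero _) f)) 0 = 0 :=
      Finsupp.mapDomain_of_notMem_range _ _ (by simp)
    simp only [A, q, LinearMap.coprod_apply, LinearMap.add_apply, LinearMap.comp_apply,
      Finsupp.add_apply, Finsupp.lmapDomain_apply, Finsupp.mapRange.linearMap_apply, this]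
    simp
    abel
  have hA1 : ∀ m f n, A (m, f) (n + 1) = f (n + 1) - s (p (f (n + 1))) + s (p (f n)) := by
    intro m f n
    have : (Finsupp.mapDomain Nat.succ (Finsupp.mapRange (s ∘ₗ p) (map_zero _) f)) (n + 1) =
        s (p (f n)) := by
      rw [← Nat.succ_eq_add_one, Finsupp.mapDomain_apply Nat.succ_injective]
      simp
    simp only [A, q, LinearMap.coprod_apply, LinearMap.add_apply, LinearMap.comp_apply,
      Finsupp.add_apply, Finsupp.lmapDomain_apply, Finsupp.mapRange.linearMap_apply, this]
    simp
  have hC1 : ∀ g, (C g).1 = p (g 0) := fun g => rfl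
  have hC2 : ∀ g n, (C g).2 n = g n - s (p (g n)) + s (p (g (n + 1))) := by
    intro g n
    simp [C, q, Finsupp.lcomapDomain]
  refine ⟨LinearEquiv.ofLinearMap A C ?_ ?_, fun m f => ⟨hA0 m f, hA1 m f⟩⟩
  · ext1 g
    apply LinearMap.ext
    intro x
    refine Finsupp.ext fun n => ?_
    rw [LinearMap.comp_apply, LinearMap.comp_apply, LinearMap.id_comp,
      ← Prod.mk.eta (p := C (Finsupp.lsingle g x))]
    cases n with
    | zero => rw [hA0, hC1, hC2]; simp [hps]
    | succ n => rw [hA1, hC2, hC2]; simp [hps]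
  · apply LinearMap.ext
    rintro ⟨m, f⟩
    rw [LinearMap.comp_apply, LinearMap.id_apply]
    refine Prod.ext ?_ (Finsupp.ext fun n => ?_)
    · rw [hC1, hA0]; simp [hps]
    · rw [hC2]
      cases n with
      | zero => rw [hA0, hA1]; simp [hps]
      | succ n => rw [hA1, hA1]; simp [hps]

end Swindle

/-! ### Free kH-bases of modules over kΓ. -/

section ModuleRepresentation

variable {k Γ : Type*} [CommRing k] [Group Γ] {H : Subgroup Γ}

/-- The representation underlying a module over the group ring. -/
noncomputable def moduleRep (k Γ M : Type*) [CommRing k] [Group Γ] [AddCommGroup M] [Module k M]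
    [Module (MonoidAlgebra k Γ) M] [SMulCommClass (MonoidAlgebra k Γ) k M] :
    Representation k Γ M where
  toFun γ :=
    { toFun := fun m => MonoidAlgebra.single γ (1 : k) • m
      map_add' := smul_add _
      map_smul' := fun n m => smul_comm _ n m }
  map_one' := by
    ext m
    exact one_smul (MonoidAlgebra k Γ) m
  map_mul' a b := by
    ext m
    simp [smul_smul]

theorem moduleRep_apply {M : Type*} [AddCommGroup M] [Module k M] [Module (MonoidAlgebra k Γ) M]
    [SMulCommClass (MonoidAlgebra k Γ) k M] (γ : Γ) (m : M) :
    moduleRep k Γ M γ m = MonoidAlgebra.single γ (1 : k) • m := rfl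

theorem exists_isFreeBasis_finsupp {X B : Type*} [AddCommGroup X] [Module k X]
    [Module (MonoidAlgebra k Γ) X] [SMulCommClass (MonoidAlgebra k Γ) k X]
    {e : Module.Basis (H × B) k X} (he : IsFreeBasis (moduleRep k Γ X) e) (J : Type*) :
    ∃ e' : Module.Basis (H × (J × B)) k (J →₀ X), IsFreeBasis (moduleRep k Γ (J →₀ X)) e' := by
  refine ⟨(Finsupp.basis fun _ : J => e).reindex
    ⟨fun p => (p.2.1, p.1, p.2.2), fun p => ⟨p.2.1, p.1, p.2.2⟩, fun _ => rfl, fun _ => rfl⟩, ?_⟩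
  rintro h h' ⟨j, i⟩
  have := he h h' i
  rw [moduleRep_apply] at this ⊢
  simp [Finsupp.coe_basis, this]

/-- The group ring is free over the group ring of a normal subgroup. -/
theorem exists_isFreeBasis_groupRing [H.Normal] :
    ∃ e : Module.Basis (H × (Γ ⧸ H)) k (MonoidAlgebra k Γ),
      IsFreeBasis (moduleRep k Γ (MonoidAlgebra k Γ)) e := by
  have hmem : ∀ γ : Γ, γ * ((γ : Γ ⧸ H).out)⁻¹ ∈ H := fun γ => by
    rw [← QuotientGroup.eq_one_iff, QuotientGroup.mk_mul, QuotientGroup.mk_inv,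
      QuotientGroup.out_eq', mul_inv_cancel]
  have hmk : ∀ (h : H) (g : Γ ⧸ H), ((h * g.out : Γ) : Γ ⧸ H) = g := fun h g => by
    rw [QuotientGroup.mk_mul, (QuotientGroup.eq_one_iff _).2 h.2, one_mul, QuotientGroup.out_eq']
  let E : Γ ≃ H × (Γ ⧸ H) :=
    { toFun := fun γ => (⟨γ * ((γ : Γ ⧸ H).out)⁻¹, hmem γ⟩, γ)
      invFun := fun p => p.1 * p.2.out
      left_inv := fun γ => by simp
      right_inv := fun p => by
        refine Prod.ext (Subtype.ext ?_) (hmk _ _)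
        simp only [hmk]
        simp }
  let b : Module.Basis Γ k (MonoidAlgebra k Γ) :=
    Module.Basis.ofRepr (MonoidAlgebra.coeffLinearEquiv k)
  have hb : ∀ γ, b γ = MonoidAlgebra.single γ 1 := fun γ => rfl
  refine ⟨b.reindex E, ?_⟩
  intro h h' g
  rw [moduleRep_apply]
  simp [hb, E, mul_assoc]

/-- The swindle isomorphism is a formula in `s` and `p`, so it is H-equivariant when they are, and
it transports the basis of F^(ℕ). -/
theorem exists_isFreeBasis_prod {M F B : Type*} [AddCommGroup M] [AddCommGroup F] [Module k M]
    [Module k F] [Module (MonoidAlgebra k Γ) M] [Module (MonoidAlgebra k Γ) F]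
    [SMulCommClass (MonoidAlgebra k Γ) k M] [SMulCommClass (MonoidAlgebra k Γ) k F]
    {e : Module.Basis (H × B) k F} (he : IsFreeBasis (moduleRep k Γ F) e)
    {s : M →ₗ[k] F} {p : F →ₗ[k] M} (hps : ∀ m, p (s m) = m)
    (hs : IsEquivariantOn H (moduleRep k Γ M) (moduleRep k Γ F) s)
    (hp : IsEquivariantOn H (moduleRep k Γ F) (moduleRep k Γ M) p) :
    ∃ e' : Module.Basis (H × (ℕ × B)) k (M × (ℕ →₀ F)),
      IsFreeBasis (moduleRep k Γ (M × (ℕ →₀ F))) e' := by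
  obtain ⟨e₁, he₁⟩ := exists_isFreeBasis_finsupp he ℕ
  obtain ⟨α, hα⟩ := exists_swindle s p hps
  have hαe : ∀ (h : H) y, α (moduleRep k Γ (M × (ℕ →₀ F)) h y) =
      moduleRep k Γ (ℕ →₀ F) h (α y) := by
    rintro h ⟨m, f⟩
    have h1 : moduleRep k Γ (M × (ℕ →₀ F)) h (m, f) =
        (moduleRep k Γ M h m, moduleRep k Γ (ℕ →₀ F) h f) := rfl
    have h2 : ∀ (g : ℕ →₀ F) n, moduleRep k Γ (ℕ →₀ F) h g n = moduleRep k Γ F h (g n) :=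
      fun _ _ => rfl
    rw [h1]
    refine Finsupp.ext fun n => ?_
    cases n with
    | zero => rw [(hα _ _).1, h2, h2, (hα _ _).1, hp _ h.2, hs _ h.2, hs _ h.2,
      map_add (moduleRep k Γ F h), map_sub (moduleRep k Γ F h)]
    | succ n =>
      rw [(hα _ _).2, h2, h2, h2, (hα _ _).2, hp _ h.2, hp _ h.2, hs _ h.2, hs _ h.2,
        map_add (moduleRep k Γ F h), map_sub (moduleRep k Γ F h)]
  refine ⟨e₁.map α.symm, fun h h' i => ?_⟩
  apply α.injective
  rw [hαe]
  simp [he₁ h h' i]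

end ModuleRepresentation

/-! ### Projectivity over ℤH and reduction to the free case. -/

section ProjectiveOverSubgroup

variable {Γ : Type u} [Group Γ] {H : Subgroup Γ}

theorem mapDomainRingHom_subtype_single (h : H) (c : ℤ) :
    MonoidAlgebra.mapDomainRingHom ℤ H.subtype (MonoidAlgebra.single h c) =
      MonoidAlgebra.single (h : Γ) c := by
  simp [MonoidAlgebra.mapDomainRingHom]

theorem single_smul_asModule {k Γ N : Type*} [CommRing k] [Group Γ] [AddCommGroup N] [Module k N]
    (σ : Representation k Γ N) (γ : Γ) (m : σ.asModule) :
    MonoidAlgebra.single γ (1 : k) • m = σ γ m := by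
  rw [Representation.single_smul, one_smul]
  rfl

theorem projectiveOverSubgroup_asModule {N B : Type*} [AddCommGroup N] {_ : Module ℤ N}
    (σ : Representation ℤ Γ N) (b : B → N) (s : N →ₗ[ℤ] B →₀ H →₀ ℤ)
    (hs : ∀ (h : H) n, s (σ h n) = leftTranslation ℤ H B h (s n))
    (hb : ∀ n, fromFree (σ.comp H.subtype) b (s n) = n) :
    ProjectiveOverSubgroup H σ.asModule := by
  unfold ProjectiveOverSubgroup
  let _ : Module (MonoidAlgebra ℤ H) σ.asModule :=
    Module.compHom σ.asModule (MonoidAlgebra.mapDomainRingHom ℤ H.subtype)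
  refine projective_of_section (M := σ.asModule) (ρ := σ.comp H.subtype) (fun h m => ?_) b s hs hb
  change _ = MonoidAlgebra.mapDomainRingHom ℤ H.subtype (MonoidAlgebra.single h 1) • m
  rw [mapDomainRingHom_subtype_single]
  exact (single_smul_asModule σ (h : Γ) m).symm

/-- The splitting is taken inside a free ℤΓ-module rather than a free ℤH-module, so that the
complement added by the swindle carries a Γ-action. -/
theorem ProjectiveOverSubgroup.exists_section {M : Type w} [AddCommGroup M] [Module ℤ M]
    [Module (MonoidAlgebra ℤ Γ) M] (hM : ProjectiveOverSubgroup H M) :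
    ∃ s : M →+ (M →₀ MonoidAlgebra ℤ Γ),
      (∀ (h : H) m, s (MonoidAlgebra.single (h : Γ) (1 : ℤ) • m) =
        MonoidAlgebra.single (h : Γ) (1 : ℤ) • s m) ∧
      ∀ m, Finsupp.linearCombination (MonoidAlgebra ℤ Γ) id (s m) = m := by
  let _ : Module (MonoidAlgebra ℤ H) M :=
    Module.compHom M (MonoidAlgebra.mapDomainRingHom ℤ H.subtype)
  have hP : Module.Projective (MonoidAlgebra ℤ H) M := hM
  let _ : Module (MonoidAlgebra ℤ H) (M →₀ MonoidAlgebra ℤ Γ) :=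
    Module.compHom _ (MonoidAlgebra.mapDomainRingHom ℤ H.subtype)
  let p : (M →₀ MonoidAlgebra ℤ Γ) →ₗ[MonoidAlgebra ℤ H] M :=
    { toFun := Finsupp.linearCombination (MonoidAlgebra ℤ Γ) id
      map_add' := map_add _
      map_smul' := fun a x => map_smul (Finsupp.linearCombination (MonoidAlgebra ℤ Γ) id)
        (MonoidAlgebra.mapDomainRingHom ℤ H.subtype a) x }
  have hp : Function.Surjective p := fun m => ⟨Finsupp.single m 1, by simp [p]⟩
  obtain ⟨s, hs⟩ := Module.projective_lifting_property p LinearMap.id hp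
  refine ⟨s.toAddMonoidHom, fun h m => ?_, fun m => LinearMap.congr_fun hs m⟩
  have := s.map_smul (MonoidAlgebra.single h 1) m
  rw [← mapDomainRingHom_subtype_single]
  exact this

/-- A module which is projective over `ℤH` is a direct summand of one which is free over `ℤH`. -/
theorem ProjectiveOverSubgroup.exists_isFreeBasis [H.Normal] {M : Type (max u w)} [AddCommGroup M]
    [Module (MonoidAlgebra ℤ Γ) M] (hM : ProjectiveOverSubgroup H M) :
    ∃ (Y : Type (max u w)) (_ : AddCommGroup Y) (_ : Module ℤ Y) (_ : Module (MonoidAlgebra ℤ Γ) Y)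
      (ρ : Representation ℤ Γ Y) (B : Type (max u w)) (e : Module.Basis (H × B) ℤ Y)
      (i : M →ₗ[MonoidAlgebra ℤ Γ] Y) (p : Y →ₗ[MonoidAlgebra ℤ Γ] M),
      IsFreeBasis ρ e ∧ (∀ γ y, ρ γ y = MonoidAlgebra.single γ (1 : ℤ) • y) ∧
      p ∘ₗ i = LinearMap.id := by
  obtain ⟨s, hs, hps⟩ := hM.exists_section
  obtain ⟨e₀, he₀⟩ := exists_isFreeBasis_groupRing (k := ℤ) (H := H)
  obtain ⟨e₁, he₁⟩ := exists_isFreeBasis_finsupp he₀ M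
  let s' : M →ₗ[ℤ] (M →₀ MonoidAlgebra ℤ Γ) :=
    { s with map_smul' := fun n m => by simp }
  let p' : (M →₀ MonoidAlgebra ℤ Γ) →ₗ[ℤ] M :=
    { (Finsupp.linearCombination (MonoidAlgebra ℤ Γ) id).toAddMonoidHom with
      map_smul' := fun n m => by simp }
  obtain ⟨e₂, he₂⟩ := exists_isFreeBasis_prod he₁ (s := s') (p := p') hps
    (fun h hh m => hs ⟨h, hh⟩ m)
    (fun h hh m => map_smul (Finsupp.linearCombination (MonoidAlgebra ℤ Γ) id) _ m)
  exact ⟨M × (ℕ →₀ M →₀ MonoidAlgebra ℤ Γ), inferInstance, inferInstance, inferInstance,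
    moduleRep ℤ Γ _, _, e₂, LinearMap.inl _ _ _, LinearMap.fst _ _ _, he₂, fun _ _ => rfl, rfl⟩

end ProjectiveOverSubgroup

/-! ### Transfer of Moore's conjecture. -/

section Transfer

variable {Γ : Type u} {Γ' : Type v} [Group Γ] [Group Γ'] {H : Subgroup Γ} {H' : Subgroup Γ'}
  [H.Normal] {φ : Γ →* Γ'} {ψ : Γ' →* Γ ⧸ H}

theorem MooreCondition.of_map (hker : ψ.ker = H') (hψφ : ∀ γ, ψ (φ γ) = γ)
    (hM : MooreCondition H') : MooreCondition H := by
  intro g hg hp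
  have h1 : φ g ∉ H' := by
    rw [← hker, MonoidHom.mem_ker, hψφ, QuotientGroup.eq_one_iff]
    exact hg
  rcases (Nat.dvd_prime hp).1 (orderOf_map_dvd φ g) with h | h
  · rw [orderOf_eq_one_iff] at h
    exact h1 (h ▸ H'.one_mem)
  · exact hM _ h1 (h ▸ hp)

theorem SatisfiesMooreConjecture.coinvariantsAreNorms [Fintype (Γ ⧸ H)] [Fintype (Γ' ⧸ H')]
    (hMoore : SatisfiesMooreConjecture.{v, max u w} H') (hker : ψ.ker = H')
    (hψφ : ∀ γ, ψ (φ γ) = γ) {W : Type (max u v w)} [AddCommGroup W]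
    {_ : Module ℤ W}
    {ρ : Representation ℤ Γ W} {B : Type*} {e : Module.Basis (H × B) ℤ W}
    (he : IsFreeBasis ρ e) : CoinvariantsAreNorms H ρ := by
  obtain ⟨N, _, _, σ, b, s, hs, hb, hnorm⟩ := exists_induced he hker hψφ
  have hproj : Module.Projective (MonoidAlgebra ℤ Γ') σ.asModule :=
    hMoore.2 σ.asModule (projectiveOverSubgroup_asModule σ b s hs hb)
  obtain ⟨t, ht, htb⟩ := exists_section_of_projective (M := σ.asModule) (ρ := σ) fun γ m =>
    (single_smul_asModule σ γ m).symm
  exact hnorm (exists_relTrace_eq_id_of_section ht htb)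

theorem SatisfiesMooreConjecture.of_quotient_iso [Fintype (Γ ⧸ H)] [Fintype (Γ' ⧸ H')]
    (hMoore : SatisfiesMooreConjecture.{v, max u w} H') (hker : ψ.ker = H')
    (hψφ : ∀ γ, ψ (φ γ) = γ) : SatisfiesMooreConjecture.{u, max v w} H := by
  refine ⟨hMoore.1.of_map hker hψφ, fun M _ _ hM => ?_⟩
  obtain ⟨Y, _, _, _, ρ, B, e, i, p, he, hρ, hpi⟩ :=
    ProjectiveOverSubgroup.exists_isFreeBasis.{u, max v w} hM
  have hloc : LocallyTrace H ρ := by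
    refine locallyTrace_of_coinvariantsAreNorms he fun A _ _ α j hj => ?_
    -- Coefficients in ℤ matter here: a subgroup of the free abelian group ℤΓ is free.
    have hfree : Module.Free ℤ (LinearMap.range j) := Submodule.free_of_isPrincipalIdealRing _
    have : Module.Free ℤ A := Module.Free.of_equiv (LinearEquiv.ofInjective j hj).symm
    obtain ⟨e', he'⟩ := exists_isFreeBasis_tprod α (Module.Free.chooseBasis ℤ A) he
    exact hMoore.coinvariantsAreNorms hker hψφ he'
  obtain ⟨θ, hθ, htr⟩ := hloc.exists_relTrace_eq_id he
  have := projective_of_relTrace_eq_id hρ he hθ htr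
  exact Module.Projective.of_split i p hpi

end Transfer

theorem mainTheorem3 {Γ : Type u} {Γ' : Type v} [Group Γ] [Group Γ']
    (H : Subgroup Γ) (H' : Subgroup Γ') [H.Normal] [H'.Normal] [H.FiniteIndex] [H'.FiniteIndex]
    (φ : Γ →* Γ') (hφ : H ≤ H'.comap φ)
    (hiso : Function.Bijective (QuotientGroup.map H H' φ hφ))
    (hMoore : SatisfiesMooreConjecture.{v, max u w} H') :
    SatisfiesMooreConjecture.{u, max v w} H := by
  let _ : Fintype (Γ ⧸ H) := H.fintypeQuotientOfFiniteIndex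
  let _ : Fintype (Γ' ⧸ H') := H'.fintypeQuotientOfFiniteIndex
  let E : Γ ⧸ H ≃* Γ' ⧸ H' := MulEquiv.ofBijective (QuotientGroup.map H H' φ hφ) hiso
  let ψ : Γ' →* Γ ⧸ H := E.symm.toMonoidHom.comp (QuotientGroup.mk' H')
  have hker : ψ.ker = H' := by
    ext x
    simp [ψ]
  have hψφ : ∀ γ, ψ (φ γ) = γ := fun γ => E.symm_apply_apply (γ : Γ ⧸ H)
  exact SatisfiesMooreConjecture.of_quotient_iso.{u, v, w} hMoore hker hψφ
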